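/- **Fixed-confidence upper bound.** *Setting.* There are $V\ge 1$ agents. Agent $v$ has $n\ge 2$ arms $x_{v,1},\dots,x_{v,n}\in\mathbb R^d$ and a task feature $z_v\in\mathcal Z$; write $\tilde x_{v,i}=(x_{v,i},z_v)$, $\tilde{\mathcal X}_v=\{\tilde x_{v,i}\}_{i}$, and let $\tilde{\mathcal X}$ be the family of all $nV$ arms $\tilde x_{v,i}$. There are a product kernel $K((x,z),(x',z'))=K_{\mathcal Z}(z,z')K_{\mathcal X}(x,x')$, a real Hilbert space $\mathcal H$, a feature map $\phi$ into $\mathcal H$ with $K(\tilde x,\tilde x')=\langle\phi(\tilde x),\phi(\tilde x')\rangle$, and an unknown $\theta^*\in\mathcal H$ with $\|\theta^*\|\le B$ for a known $B>0$. The expected reward of an arm is $f(\tilde x)=\langle\phi(\tilde x),\theta^*\rangle$. Each $\tilde{\mathcal X}_v$ has a unique best arm $\tilde x^*_v$; $\Delta_{\min}>0$ is the minimum of $f(\tilde x^*_v)-f(\tilde x)$ over $v$ and $\tilde x\in\tilde{\mathcal X}_v\setminus\{\tilde x_v^*\}$. The $\tau$-th sample of agent $v$ is the expected reward of the sampled arm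 plus noise that is zero-mean, $1$-sub-Gaussian, and independent over all $(v,\tau)$ (its law may depend on the arm). Let $\delta\in(0,1)$, $\varepsilon>0$, let $\triangle$ be the set of probability distributions on $\tilde{\mathcal X}$, $A(c,w)=cI+\sum_{\tilde x\in\tilde{\mathcal X}} w_{\tilde x}\phi(\tilde x)\phi(\tilde x)^\top$, $\|u\|^2_{A^{-1}}=\langle u,A^{-1}u\rangle$, and, for alive sets $\mathcal B=(\mathcal B_v)_v$, $h_{c,\mathcal B}(w)=\max_{v}\max_{\tilde x,\tilde x'\in\mathcal B_v}\|\phi(\tilde x)-\phi(\tilde x')\|^2_{A(c,w)^{-1}}$. The regularization parameters $\xi_t>0$, $t\ge1$, satisfy $$\sqrt{\xi_t}\,\max_{v}\max_{\tilde x,\tilde x'\in\tilde{\mathcal X}_v}\|\phi(\tilde x)-\phi(\tilde x')\|_{A(\xi_t,\,1/(nV))^{-1}}\le \frac1{(1+\varepsilon)B\,2^{t+1}} .$$ *Algorithm $\mathsf{CoopKernelFC}$.* Start with $\mathcal B_v^{(1)}=\tilde{\mathcal X}_v$ and $t=1$. While some $|\mathcal B^{(t)}_v|>1$: put $\delta_t=\delta/(2t^2)$;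 let $\lambda_t^*$ and $\rho_t^*$ be a minimizer and the minimum of $h_{\xi_t,\mathcal B^{(t)}}$ over $\triangle$; put $N^{(t)}=\lceil 8(2^t)^2(1+\varepsilon)^2\rho^*_t\log(2n^2V/\delta_t)\rceil$; let $\mathsf{ROUND}_\varepsilon(\lambda^*_t,N^{(t)})$ return a sequence of $N^{(t)}$ arms; each agent samples the subsequence of its own arms and broadcasts, for each of its arms, the number of samples and the average observed reward in this phase (one communication round). With $N_{\tilde x}$ and $\bar y_{\tilde x}$ denoting these numbers, $k_t(\tilde x)=(\sqrt{N_{\tilde x'}}K(\tilde x,\tilde x'))_{\tilde x'}$, $K^{(t)}=(\sqrt{N_{\tilde x}N_{\tilde x'}}K(\tilde x,\tilde x'))_{\tilde x,\tilde x'}$ and $\bar{\boldsymbol y}=(\sqrt{N_{\tilde x}}\,\bar y_{\tilde x})_{\tilde x}$, put $\hat\Delta_t(\tilde x,\tilde x')=(k_t(\tilde x)-k_t(\tilde x'))^\top(K^{(t)}+N^{(t)}\xi_tI)^{-1}\bar{\boldsymbol y}$, remove from each $\mathcal B_v^{(t)}$ every $\tilde x$ for which some $\tilde x'\in\mathcal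 B^{(t)}_v$ has $\hat\Delta_t(\tilde x',\tilde x)\ge2^{-t}$, which gives $\mathcal B_v^{(t+1)}$, and increase $t$ by $1$. When the loop ends, return the sets $\mathcal B^{(t)}_v$. The rounding procedure $\mathsf{ROUND}_\varepsilon$ is assumed to meet its guarantee in all calls that the algorithm makes: the numbers $\kappa_{\tilde x}$ of occurrences in the returned sequence satisfy $$h_{N^{(t)}\xi_t,\mathcal B^{(t)}}(\kappa)\le(1+\varepsilon)\,h_{N^{(t)}\xi_t,\mathcal B^{(t)}}(N^{(t)}\lambda^*_t).$$ *Theorem.* Let $$\rho^*=\min_{\lambda\in\triangle}\ \max_{v}\ \max_{\tilde x\in\tilde{\mathcal X}_v\setminus\{\tilde x^*_v\}}\frac{\|\phi(\tilde x^*_v)-\phi(\tilde x)\|^2_{A(\xi_*,\lambda)^{-1}}}{(f(\tilde x^*_v)-f(\tilde x))^2},\qquad \xi_*=\min_{1\le t\le t^*}\xi_t,$$ where $t^*=\max\{0,\lceil\log_2\Delta_{\min}^{-1}\rceil\}+1$, and let $L=\max\{1,\log\Delta_{\min}^{-1}\}$ (so $L=\log \Delta_{\min}^{-1}$ if $\Delta_{\min}\le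 1/e$). With probability at least $1-\delta$, $\mathsf{CoopKernelFC}$ terminates and returns $\{\tilde x^*_v\}$ for every agent $v$, and at the same time the average number $S$ of samples used by each agent satisfies $$S\le C\cdot\frac{\rho^*}{V}\cdot L\cdot\Bigl(\log\frac{nV}\delta+\log L\Bigr)$$ and the number of communication rounds is at most $C_0L$. Here $C_0$ is a universal constant, and $C$ depends only on $\varepsilon$, on $B$ and on an upper bound $\kappa$ of $K(\tilde x,\tilde x)$ over the arms. -/

import Mathlib

open MeasureTheory ProbabilityTheory

universe u v w

noncomputable section

namespace CoopKernel

/-- An arm, given as (agent, position of the arm in the arm set of that agent). -/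
abbrev Arm (V n : ℕ) := Fin V × Fin n

/-- A family of alive arm sets, one for each agent. -/
abbrev Alive (V n : ℕ) := Fin V → Finset (Fin n)

/-- What is known about the arms of a collaborative kernel bandit with `V` agents and `n` arms per
agent: arm features in `ℝ^d`, one task feature per agent, an arm kernel, a task kernel, and a
feature map into a Hilbert space `H` which represents the product kernel on `𝒳 × Z`, where `𝒳` is
the union of the arm sets of all agents. -/
structure Model (d V n : ℕ) (Z : Type u) (H : Type v) [NormedAddCommGroup H]
    [InnerProductSpace ℝ H] where
  arm : Fin V → Fin n → EuclideanSpace ℝ (Fin d)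
  task : Fin V → Z
  kernelX : EuclideanSpace ℝ (Fin d) → EuclideanSpace ℝ (Fin d) → ℝ
  kernelZ : Z → Z → ℝ
  feature : EuclideanSpace ℝ (Fin d) × Z → H
  inner_feature : ∀ p q : EuclideanSpace ℝ (Fin d) × Z,
    (∃ v i, arm v i = p.1) → (∃ v i, arm v i = q.1) →
      inner ℝ (feature p) (feature q) = kernelZ p.2 q.2 * kernelX p.1 q.1

variable {d V n : ℕ} {Z : Type u} {H : Type v} [NormedAddCommGroup H] [InnerProductSpace ℝ H]

namespace Model

variable (M : Model d V n Z H)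

/-- The pair (arm feature, task feature) of an arm. -/
def point (a : Arm V n) : EuclideanSpace ℝ (Fin d) × Z := (M.arm a.1 a.2, M.task a.1)

/-- The feature vector of an arm. -/
def phi (a : Arm V n) : H := M.feature (M.point a)

/-- The product kernel, evaluated at two arms. -/
def kernel (a b : Arm V n) : ℝ :=
  M.kernelZ (M.point a).2 (M.point b).2 * M.kernelX (M.point a).1 (M.point b).1

/-- The global reward function `F(x, z) = ⟪φ(x, z), θ⟫`. -/
def globalReward (θ : H) (p : EuclideanSpace ℝ (Fin d) × Z) : ℝ := inner ℝ (M.feature p) θ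

/-- The expected reward of an arm, `f_v(x) = F(x, z_v)`. -/
def reward (θ : H) (a : Arm V n) : ℝ := M.globalReward θ (M.point a)

/-- The operator `c I + ∑ w_x φ(x) φ(x)ᵀ` on `H`, with the sum over all arms. -/
def designOp (c : ℝ) (w : Arm V n → ℝ) : H →L[ℝ] H :=
  c • ContinuousLinearMap.id ℝ H + ∑ a, w a • InnerProductSpace.rankOne ℝ (M.phi a) (M.phi a)

/-- `‖u‖²` in the norm given by the inverse of `c I + ∑ w_x φ(x) φ(x)ᵀ`. -/
def invNormSq (c : ℝ) (w : Arm V n → ℝ) (u : H) : ℝ :=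
  inner ℝ u ((M.designOp c w).inverse u)

/-- The largest `‖φ(x_i) - φ(x_j)‖²`, in the norm above, over the agents and over the pairs of arms
in the set of the agent. -/
def designValue (c : ℝ) (w : Arm V n → ℝ) (S : Alive V n) : ℝ :=
  ⨆ q : {q : Fin V × Fin n × Fin n // q.2.1 ∈ S q.1 ∧ q.2.2 ∈ S q.1},
    M.invNormSq c w (M.phi (q.1.1, q.1.2.1) - M.phi (q.1.1, q.1.2.2))

/-- The optimal value of the design problem over all distributions on the arms. -/
def optValue (c : ℝ) (S : Alive V n) : ℝ :=
  ⨅ w : stdSimplex ℝ (Arm V n), M.designValue c w S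

/-- `w` is an optimal solution of the design problem. -/
def IsOptAlloc (c : ℝ) (S : Alive V n) (w : Arm V n → ℝ) : Prop :=
  w ∈ stdSimplex ℝ (Arm V n) ∧ IsMinOn (fun w' => M.designValue c w' S) (stdSimplex ℝ (Arm V n)) w

/-- The condition on the regularization parameter `ξ` of phase `t`. -/
def RegCondition (ε B : ℝ) (t : ℕ) (ξ : ℝ) : Prop :=
  √ξ * (⨆ q : Fin V × Fin n × Fin n,
      √(M.invNormSq ξ (fun _ => 1 / ((n : ℝ) * V)) (M.phi (q.1, q.2.1) - M.phi (q.1, q.2.2))))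
    ≤ 1 / ((1 + ε) * B * 2 ^ (t + 1))

/-- The sequence `s` of arms rounds the allocation `w` to `N` samples, with factor `1 + ε`. -/
def IsRounding (ε ξ : ℝ) (S : Alive V n) (w : Arm V n → ℝ) (N : ℕ) (s : List (Arm V n)) : Prop :=
  s.length = N ∧
    M.designValue (N * ξ) (fun a => (s.count a : ℝ)) S
      ≤ (1 + ε) * M.designValue (N * ξ) (fun a => N * w a) S

end Model

/-- The input of the algorithm: confidence `δ`, approximation parameter `ε`, the regularization
parameters `ξ_t`, a solver of the design problem and a rounding procedure. -/
structure Config (V n : ℕ) where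
  δ : ℝ
  ε : ℝ
  ξ : ℕ → ℝ
  /-- `solver ξ S` is the allocation used for regularization `ξ` and alive sets `S`. -/
  solver : ℝ → Alive V n → Arm V n → ℝ
  /-- `round ξ S w N` is the sequence of arms that rounds `w` to `N` samples. -/
  round : ℝ → Alive V n → (Arm V n → ℝ) → ℕ → List (Arm V n)

/-- The state of an execution. `clock v` is the number of samples which agent `v` has used so far;
`rounds` is the number of communication rounds so far. -/
structure State (V n : ℕ) where
  phase : ℕ
  alive : Alive V n
  clock : Fin V → ℕ
  rounds : ℕ

/-- The initial state: phase 1, all arms alive. -/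
def State.init (V n : ℕ) : State V n := ⟨1, fun _ => Finset.univ, fun _ => 0, 0⟩

/-- The condition of the while loop. -/
def State.Running (s : State V n) : Prop := ∃ v, 1 < (s.alive v).card

/-- A broadcast of an agent: for each of its arms, the number of samples and the average observed
reward in the current phase. -/
abbrev Message (n : ℕ) := Fin n → ℕ × ℝ

/-- The positions of the arms of agent `v` in a sequence of arms, in the order of the sequence. -/
def agentSeq (s : List (Arm V n)) (v : Fin V) : List (Fin n) :=
  (s.filter fun a => a.1 = v).map Prod.snd

/-- The message of an agent which pulls the sequence `s` of its arms after having used `c` samples,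
when the reward of its `τ`-th sample is `y τ i` if that sample is of arm `i`. -/
def message (y : ℕ → Fin n → ℝ) (c : ℕ) (s : List (Fin n)) : Message n := fun i =>
  (s.count i,
    (∑ m : Fin s.length, if s.get m = i then y (c + m) i else 0) / (s.count i : ℝ))

section Estimator

variable (M : Model d V n Z H) (msg : Fin V → Message n)

/-- `k_t(x)`. -/
def kernelVec (x : Arm V n) : Arm V n → ℝ := fun a => √((msg a.1 a.2).1 : ℝ) * M.kernel x a

/-- `K^{(t)}`. -/
def kernelMat : Matrix (Arm V n) (Arm V n) ℝ :=
  Matrix.of fun a b => √(((msg a.1 a.2).1 : ℝ) * (msg b.1 b.2).1) * M.kernel a b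

/-- The weighted vector of average observations. -/
def obsVec : Arm V n → ℝ := fun a => √((msg a.1 a.2).1 : ℝ) * (msg a.1 a.2).2

/-- The estimated reward gap between `x` and `x'`, with regularization `c = N^{(t)} ξ_t`. -/
def gapEst (c : ℝ) (x x' : Arm V n) : ℝ :=
  dotProduct (kernelVec M msg x - kernelVec M msg x')
    ((kernelMat M msg + c • (1 : Matrix (Arm V n) (Arm V n) ℝ))⁻¹.mulVec (obsVec msg))

end Estimator

section Algorithm

variable (M : Model d V n Z H) (cfg : Config V n)

/-- `δ_t`. -/
def Config.deltaAt (t : ℕ) : ℝ := cfg.δ / (2 * (t : ℝ) ^ 2)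

/-- `N^{(t)}`. -/
def numSamples (t : ℕ) (S : Alive V n) : ℕ :=
  ⌈8 * ((2 : ℝ) ^ t) ^ 2 * (1 + cfg.ε) ^ 2 * M.optValue (cfg.ξ t) S *
    Real.log (2 * (n : ℝ) ^ 2 * V / cfg.deltaAt t)⌉₊

/-- `λ*_t`. -/
def phaseAlloc (s : State V n) : Arm V n → ℝ := cfg.solver (cfg.ξ s.phase) s.alive

/-- The overall sequence of samples of the current phase. -/
def phaseSeq (s : State V n) : List (Arm V n) :=
  cfg.round (cfg.ξ s.phase) s.alive (phaseAlloc cfg s) (numSamples M cfg s.phase s.alive)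

/-- The messages that are exchanged in the current phase. `y v τ i` is the reward of agent `v` for
its `τ`-th sample, if that sample is of arm `i`. -/
def phaseMessages (y : Fin V → ℕ → Fin n → ℝ) (s : State V n) : Fin V → Message n := fun v =>
  message (y v) (s.clock v) (agentSeq (phaseSeq M cfg s) v)

/-- The alive sets after the elimination at the end of the current phase. -/
def eliminate (msg : Fin V → Message n) (s : State V n) : Alive V n := fun v =>
  haveI := Classical.decPred fun i => ∃ j ∈ s.alive v,
    (1 / 2 : ℝ) ^ s.phase ≤
      gapEst M msg (numSamples M cfg s.phase s.alive * cfg.ξ s.phase) (v, j) (v, i)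
  s.alive v \ (s.alive v).filter fun i => ∃ j ∈ s.alive v,
    (1 / 2 : ℝ) ^ s.phase ≤
      gapEst M msg (numSamples M cfg s.phase s.alive * cfg.ξ s.phase) (v, j) (v, i)

/-- One phase of the algorithm. All agents compute the alive sets from the same messages, so their
copies of the alive sets agree. -/
def step (y : Fin V → ℕ → Fin n → ℝ) (s : State V n) : State V n where
  phase := s.phase + 1
  alive := eliminate M cfg (phaseMessages M cfg y s) s
  clock := fun v => s.clock v + (agentSeq (phaseSeq M cfg s) v).length
  rounds := s.rounds + 1

/-- The state after `k` phases. -/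
def run (y : Fin V → ℕ → Fin n → ℝ) (k : ℕ) : State V n := (step M cfg y)^[k] (State.init V n)

/-- The while loop enters phase `k + 1`. -/
def Enters (y : Fin V → ℕ → Fin n → ℝ) (k : ℕ) : Prop := ∀ j ≤ k, (run M cfg y j).Running

/-- The algorithm terminates, in the state `s`. -/
def TerminatesIn (y : Fin V → ℕ → Fin n → ℝ) (s : State V n) : Prop :=
  ∃ k, (∀ j < k, (run M cfg y j).Running) ∧ ¬ (run M cfg y k).Running ∧ run M cfg y k = s

/-- The inputs of the algorithm are as required: the regularization parameters are positive and
satisfy their condition, and the solver returns optimal allocations. -/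
structure Config.Valid (B : ℝ) : Prop where
  ε_pos : 0 < cfg.ε
  δ_pos : 0 < cfg.δ
  δ_lt_one : cfg.δ < 1
  ξ_pos : ∀ t, 1 ≤ t → 0 < cfg.ξ t
  ξ_cond : ∀ t, 1 ≤ t → M.RegCondition cfg.ε B t (cfg.ξ t)
  solver_opt : ∀ t, 1 ≤ t → ∀ S, M.IsOptAlloc (cfg.ξ t) S (cfg.solver (cfg.ξ t) S)

/-- The rounding procedure meets its guarantee whenever it is called in the execution on the reward
table `y`. -/
def RoundsWell (y : Fin V → ℕ → Fin n → ℝ) : Prop :=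
  ∀ k, Enters M cfg y k →
    let s := run M cfg y k
    M.IsRounding cfg.ε (cfg.ξ s.phase) s.alive (phaseAlloc cfg s)
      (numSamples M cfg s.phase s.alive) (phaseSeq M cfg s)

end Algorithm

section Hardness

variable (M : Model d V n Z H) (θ : H) (best : Fin V → Fin n)

/-- The gap between the best arm of the agent of `a` and the arm `a`. -/
def gap (a : Arm V n) : ℝ := M.reward θ (a.1, best a.1) - M.reward θ a

/-- The minimum gap over all agents and all their suboptimal arms. -/
def minGap : ℝ := ⨅ a : {a : Arm V n // a.2 ≠ best a.1}, gap M θ best a.1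

/-- The hardness `ρ*` with regularization `ξ`. -/
def hardness (ξ : ℝ) : ℝ :=
  ⨅ w : stdSimplex ℝ (Arm V n), ⨆ a : {a : Arm V n // a.2 ≠ best a.1},
    M.invNormSq ξ w (M.phi (a.1.1, best a.1.1) - M.phi a.1) / gap M θ best a.1 ^ 2

end Hardness

/-- The index of the last phase, `⌈log₂ Δ⁻¹⌉ + 1` (and `1` if `Δ > 1`). -/
def lastPhase (Δ : ℝ) : ℕ := ⌈Real.logb 2 Δ⁻¹⌉₊ + 1

/-- `min ξ_t` over the phases `1 ≤ t ≤ T`. -/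
def minReg (ξ : ℕ → ℝ) (T : ℕ) : ℝ := ⨅ t : Set.Icc 1 T, ξ t

/-- `log Δ⁻¹`, replaced by `1` where it is smaller than `1`. -/
def logInv (Δ : ℝ) : ℝ := max 1 (Real.log Δ⁻¹)

/-- The hardness `ρ*` of the instance, with regularization `ξ_* = min ξ_t`. -/
def rhoStar (M : Model d V n Z H) (θ : H) (best : Fin V → Fin n) (ξ : ℕ → ℝ) : ℝ :=
  hardness M θ best (minReg ξ (lastPhase (minGap M θ best)))

/-- The reward table for expected rewards given by `θ` and noise `η`: agent `v` observes
`f_v(x_i) + η v τ i` if its `τ`-th sample is of arm `i`. -/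
def rewardTable (M : Model d V n Z H) (θ : H) {Ω : Type w} (η : Fin V → ℕ → Fin n → Ω → ℝ)
    (ω : Ω) : Fin V → ℕ → Fin n → ℝ := fun v τ i => M.reward θ (v, i) + η v τ i ω

/-- The average number of samples used by each agent. -/
def State.perAgentSamples (s : State V n) : ℝ := (∑ v, (s.clock v : ℝ)) / V

end CoopKernel

end

/-! ### Quadratic forms of the regularized design operator -/

namespace CoopKernel

variable {d V n : ℕ} {Z : Type u} {H : Type v} [NormedAddCommGroup H] [InnerProductSpace ℝ H]

namespace Model

variable (M : Model d V n Z H)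

/-! In feature space the estimate is ridge regression, so its error on a pair of arms is a linear
combination of the noise of the phase minus a regularization bias (`gapEst_sub_reward`). With `u`
the feature difference and `c = N ξ`, the squared noise coefficients sum to at most `‖u‖²_{A⁻¹}` and
the bias is at most `B √(c ‖u‖²_{A⁻¹})`. Rounding and optimality of the allocation give `‖u‖²_{A⁻¹}
≤ (1+ε) ρ_t / N`. The condition on `ξ_t`, tested on the uniform design, then keeps the bias below
`2^{-t}/2`, and the choice of `N` makes the noise exceed `2^{-t}/2` with probability at most `δ_t /
(2 n² V)` (`measure_pair_inaccurate_le`).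

The tail bound needs a fixed sample sequence, while the algorithm is adaptive. Once the state at the
start of a phase is fixed, its samples are determined, and they read only rewards beyond the current
clocks; the event of reaching that state reads only earlier rewards. These events are independent,
and there are countably many states, so a bound for fixed states carries over to the execution
(`measure_run_inaccurate_le`). A union bound over pairs and phases costs at most `δ`.

The rest is deterministic. Accurate phases never remove a best arm and leave only gaps below `2 ·
2^{-t}`, so the loop ends by `lastPhase` (`exists_terminates`). Splitting differences of alive arms
through the best arm gives `4^t ρ_t ≤ 64 G² ρ*` with `G = max 1 (√κ B)`
(`optValue_mul_le_hardness`). The `+1` of the ceiling is absorbed because `ρ*` is bounded below by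
`1 / (2 κ B²)` (`one_le_mul_rhoStar`). -/

lemma inner_phi (a b : Arm V n) : inner ℝ (M.phi a) (M.phi b) = M.kernel a b :=
  M.inner_feature _ _ ⟨a.1, a.2, rfl⟩ ⟨b.1, b.2, rfl⟩

lemma reward_eq_inner (θ : H) (a : Arm V n) : M.reward θ a = inner ℝ (M.phi a) θ := rfl

lemma designOp_apply (c : ℝ) (w : Arm V n → ℝ) (x : H) :
    M.designOp c w x = c • x + ∑ a, (w a * inner ℝ (M.phi a) x) • M.phi a := by
  simp [designOp, _root_.sum_apply, smul_smul]

lemma inner_designOp (c : ℝ) (w : Arm V n → ℝ) (x y : H) :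
    inner ℝ (M.designOp c w x) y
      = c * inner ℝ x y + ∑ a, w a * (inner ℝ (M.phi a) x * inner ℝ (M.phi a) y) := by
  rw [designOp_apply, inner_add_left, sum_inner, real_inner_smul_left]
  congr 1
  exact Finset.sum_congr rfl fun a _ => by rw [real_inner_smul_left, mul_assoc]

lemma inner_designOp_self (c : ℝ) (w : Arm V n → ℝ) (x : H) :
    inner ℝ (M.designOp c w x) x = c * ‖x‖ ^ 2 + ∑ a, w a * inner ℝ (M.phi a) x ^ 2 := by
  rw [inner_designOp, real_inner_self_eq_norm_sq]
  simp [sq]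

lemma inner_designOp_symm (c : ℝ) (w : Arm V n → ℝ) (x y : H) :
    inner ℝ (M.designOp c w x) y = inner ℝ x (M.designOp c w y) := by
  rw [← real_inner_comm x, inner_designOp, inner_designOp, real_inner_comm]
  congr 1
  exact Finset.sum_congr rfl fun a _ => by ring

section Inverse

variable {M} {c : ℝ} {w : Arm V n → ℝ}

lemma sum_weight_sq_nonneg (hw : 0 ≤ w) (x : H) : 0 ≤ ∑ a, w a * inner ℝ (M.phi a) x ^ 2 :=
  Finset.sum_nonneg fun a _ => mul_nonneg (hw a) (sq_nonneg _)

variable [CompleteSpace H]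

/-- The quadratic form is at least `c ‖x‖²`, so the operator is coercive, and coercive operators on
a complete space are invertible. -/
lemma isInvertible_designOp (hc : 0 < c) (hw : 0 ≤ w) : (M.designOp c w).IsInvertible := by
  have hu : IsUnit (M.designOp c w) := by
    refine ContinuousLinearMap.isUnit_of_forall_le_norm_inner_map _
      (c := ⟨c, hc.le⟩) hc fun x => ?_
    rw [inner_designOp_self, Real.norm_eq_abs]
    refine le_trans ?_ (le_abs_self _)
    have := sum_weight_sq_nonneg (M := M) hw x
    change ‖x‖ ^ 2 * c ≤ _
    linarith
  obtain ⟨U, hU⟩ := hu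
  exact ⟨ContinuousLinearEquiv.ofUnit U, hU⟩

lemma designOp_inverse (hc : 0 < c) (hw : 0 ≤ w) (x : H) :
    M.designOp c w ((M.designOp c w).inverse x) = x :=
  (((isInvertible_designOp hc hw).inverse_apply_eq).1 rfl).symm

lemma inverse_eq_of_designOp_eq (hc : 0 < c) (hw : 0 ≤ w) {x y : H}
    (h : M.designOp c w x = y) : (M.designOp c w).inverse y = x :=
  (isInvertible_designOp hc hw).inverse_apply_eq.2 h.symm

lemma inner_inverse_comm (hc : 0 < c) (hw : 0 ≤ w) (x y : H) :
    inner ℝ x ((M.designOp c w).inverse y) = inner ℝ ((M.designOp c w).inverse x) y := by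
  conv_lhs => rw [← designOp_inverse (M := M) hc hw x]
  conv_rhs => rw [← designOp_inverse (M := M) hc hw y]
  rw [inner_designOp_symm, designOp_inverse hc hw y]

lemma invNormSq_eq (hc : 0 < c) (hw : 0 ≤ w) (x : H) :
    M.invNormSq c w x = c * ‖(M.designOp c w).inverse x‖ ^ 2
      + ∑ a, w a * inner ℝ (M.phi a) ((M.designOp c w).inverse x) ^ 2 := by
  rw [← inner_designOp_self, designOp_inverse hc hw]
  rfl

lemma invNormSq_nonneg (hc : 0 < c) (hw : 0 ≤ w) (x : H) : 0 ≤ M.invNormSq c w x := by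
  rw [invNormSq_eq hc hw]
  have := sum_weight_sq_nonneg (M := M) hw ((M.designOp c w).inverse x)
  positivity

lemma mul_norm_inverse_sq_le (hc : 0 < c) (hw : 0 ≤ w) (x : H) :
    c * ‖(M.designOp c w).inverse x‖ ^ 2 ≤ M.invNormSq c w x := by
  rw [invNormSq_eq hc hw]
  have := sum_weight_sq_nonneg (M := M) hw ((M.designOp c w).inverse x)
  linarith

/-- With `y = A⁻¹ x`, the left side is `⟨A y, y⟩` without its `c ‖y‖²` term. This bounds the
variance proxy of the noise. -/
lemma sum_weight_inverse_sq_le (hc : 0 < c) (hw : 0 ≤ w) (x : H) :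
    ∑ a, w a * inner ℝ x ((M.designOp c w).inverse (M.phi a)) ^ 2 ≤ M.invNormSq c w x := by
  rw [invNormSq_eq hc hw]
  have h : ∀ a, inner ℝ x ((M.designOp c w).inverse (M.phi a))
      = inner ℝ (M.phi a) ((M.designOp c w).inverse x) := fun a => by
    rw [inner_inverse_comm hc hw, real_inner_comm]
  simp only [h]
  have : 0 ≤ c * ‖(M.designOp c w).inverse x‖ ^ 2 := by positivity
  linarith

/-- Positivity of the form at `x - A⁻¹ u`. Together with `invNormSq_eq_variational`, it presents
`‖u‖²_{A⁻¹}` as a maximum over `x`, so comparisons of inverses reduce to comparisons of the forms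
themselves. -/
lemma le_invNormSq (hc : 0 < c) (hw : 0 ≤ w) (u x : H) :
    2 * inner ℝ u x - inner ℝ (M.designOp c w x) x ≤ M.invNormSq c w u := by
  set y := (M.designOp c w).inverse u with hy
  have h1 : 0 ≤ inner ℝ (M.designOp c w (x - y)) (x - y) := by
    rw [inner_designOp_self]
    have := sum_weight_sq_nonneg (M := M) hw (x - y)
    positivity
  have h2 : M.designOp c w y = u := designOp_inverse hc hw u
  have h3 : inner ℝ (M.designOp c w x) y = inner ℝ u x := by
    rw [inner_designOp_symm, h2, real_inner_comm]
  have h4 : M.invNormSq c w u = inner ℝ u y := rfl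
  rw [map_sub, inner_sub_left, inner_sub_right, inner_sub_right, h2, h3] at h1
  linarith

lemma invNormSq_eq_variational (hc : 0 < c) (hw : 0 ≤ w) (u : H) :
    M.invNormSq c w u = 2 * inner ℝ u ((M.designOp c w).inverse u)
      - inner ℝ (M.designOp c w ((M.designOp c w).inverse u)) ((M.designOp c w).inverse u) := by
  rw [designOp_inverse hc hw, invNormSq]
  ring

lemma invNormSq_anti {c' : ℝ} (hc : 0 < c) (hcc : c ≤ c') (hw : 0 ≤ w) (u : H) :
    M.invNormSq c' w u ≤ M.invNormSq c w u := by
  rw [invNormSq_eq_variational (hc.trans_le hcc) hw]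
  refine le_trans ?_ (le_invNormSq hc hw u ((M.designOp c' w).inverse u))
  rw [inner_designOp_self, inner_designOp_self]
  gcongr

/-- The weights sum to one and `‖φ‖² ≤ κ`, so the form is at most `(c + κ) ‖u‖²`; the test vector
`(c + κ)⁻¹ u` in the variational bound is optimal for that majorant. -/
lemma norm_sq_div_le_invNormSq {κ : ℝ} (hc : 0 < c) (hw : w ∈ stdSimplex ℝ (Arm V n))
    (hκ : ∀ a, M.kernel a a ≤ κ) (hκ0 : 0 ≤ κ) (u : H) :
    ‖u‖ ^ 2 / (c + κ) ≤ M.invNormSq c w u := by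
  refine le_trans ?_ (le_invNormSq hc hw.1 u ((c + κ)⁻¹ • u))
  have hpos : 0 < c + κ := by linarith
  have h1 : inner ℝ (M.designOp c w u) u ≤ (c + κ) * ‖u‖ ^ 2 := by
    rw [inner_designOp_self, add_mul]
    have : ∑ a, w a * inner ℝ (M.phi a) u ^ 2 ≤ ∑ a, w a * (κ * ‖u‖ ^ 2) := by
      refine Finset.sum_le_sum fun a _ => mul_le_mul_of_nonneg_left ?_ (hw.1 a)
      have h := abs_real_inner_le_norm (M.phi a) u
      have h2 : ‖M.phi a‖ ^ 2 ≤ κ := by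
        rw [← real_inner_self_eq_norm_sq, inner_phi]
        exact hκ a
      calc inner ℝ (M.phi a) u ^ 2 = |inner ℝ (M.phi a) u| ^ 2 := (sq_abs _).symm
        _ ≤ (‖M.phi a‖ * ‖u‖) ^ 2 := by gcongr
        _ = ‖M.phi a‖ ^ 2 * ‖u‖ ^ 2 := mul_pow _ _ _
        _ ≤ κ * ‖u‖ ^ 2 := by gcongr
    rw [← Finset.sum_mul, hw.2, one_mul] at this
    linarith
  rw [map_smul, real_inner_smul_left, real_inner_smul_right, real_inner_smul_right,
    real_inner_self_eq_norm_sq]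
  have h2 : (c + κ)⁻¹ * ((c + κ)⁻¹ * inner ℝ (M.designOp c w u) u)
      ≤ (c + κ)⁻¹ * ((c + κ)⁻¹ * ((c + κ) * ‖u‖ ^ 2)) := by gcongr
  rw [inv_mul_cancel_left₀ hpos.ne'] at h2
  rw [div_eq_inv_mul]
  linarith

/-- Parallelogram identity, with the nonnegative term of `x + y` dropped. -/
lemma invNormSq_sub_le (hc : 0 < c) (hw : 0 ≤ w) (x y : H) :
    M.invNormSq c w (x - y) ≤ 2 * M.invNormSq c w x + 2 * M.invNormSq c w y := by
  have h := invNormSq_nonneg (M := M) hc hw (x + y)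
  simp only [invNormSq, map_add, map_sub, inner_add_left, inner_add_right, inner_sub_left,
    inner_sub_right] at h ⊢
  linarith

lemma invNormSq_smul {r : ℝ} (hr : 0 < r) (hc : 0 < c) (hw : 0 ≤ w) (u : H) :
    M.invNormSq (r * c) (fun a => r * w a) u = M.invNormSq c w u / r := by
  have h : M.designOp (r * c) (fun a => r * w a) (r⁻¹ • (M.designOp c w).inverse u) = u := by
    conv_rhs => rw [← designOp_inverse (M := M) hc hw u]
    simp only [designOp_apply, smul_smul, inner_smul_right]
    congr 1
    · congr 1; field_simp
    · refine Finset.sum_congr rfl fun a _ => ?_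
      congr 1; field_simp
  rw [invNormSq, inverse_eq_of_designOp_eq (mul_pos hr hc)
    (fun a => mul_nonneg hr.le (hw a)) h, real_inner_smul_right, invNormSq, div_eq_inv_mul]

/-- Bounds the regularization bias: Cauchy–Schwarz after moving the inverse to `u`, then `c ‖A⁻¹ u‖²
≤ ‖u‖²_{A⁻¹}`. -/
lemma mul_abs_inner_inverse_le {B : ℝ} {θ : H} (hθ : ‖θ‖ ≤ B) (hc : 0 < c) (hw : 0 ≤ w) (u : H) :
    c * |inner ℝ u ((M.designOp c w).inverse θ)| ≤ B * √(c * M.invNormSq c w u) := by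
  rw [inner_inverse_comm hc hw]
  set y := (M.designOp c w).inverse u
  have h1 : c * ‖y‖ ≤ √(c * M.invNormSq c w u) := by
    refine Real.le_sqrt_of_sq_le ?_
    have := mul_norm_inverse_sq_le (M := M) hc hw u
    calc (c * ‖y‖) ^ 2 = c * (c * ‖y‖ ^ 2) := by ring
      _ ≤ _ := by gcongr
  calc c * |inner ℝ y θ| ≤ c * (‖y‖ * ‖θ‖) := by gcongr; exact abs_real_inner_le_norm _ _
    _ = ‖θ‖ * (c * ‖y‖) := by ring
    _ ≤ B * √(c * M.invNormSq c w u) := by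
      gcongr
      exact (norm_nonneg θ).trans hθ

end Inverse

/-! ### Values of the design problem -/

section Design

variable {M} {c : ℝ} {w : Arm V n → ℝ}

lemma invNormSq_le_designValue (S : Alive V n) {v : Fin V} {i j : Fin n}
    (hi : i ∈ S v) (hj : j ∈ S v) :
    M.invNormSq c w (M.phi (v, i) - M.phi (v, j)) ≤ M.designValue c w S :=
  le_ciSup (f := fun q : {q : Fin V × Fin n × Fin n // q.2.1 ∈ S q.1 ∧ q.2.2 ∈ S q.1} =>
    M.invNormSq c w (M.phi (q.1.1, q.1.2.1) - M.phi (q.1.1, q.1.2.2)))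
    (Set.finite_range _).bddAbove ⟨(v, i, j), hi, hj⟩

lemma designValue_le {S : Alive V n} {r : ℝ} (hr : 0 ≤ r)
    (h : ∀ v, ∀ i ∈ S v, ∀ j ∈ S v, M.invNormSq c w (M.phi (v, i) - M.phi (v, j)) ≤ r) :
    M.designValue c w S ≤ r :=
  -- Nonnegativity of `r` covers an empty family of pairs, whose real supremum is `0`.
  Real.iSup_le (fun q => h _ _ q.2.1 _ q.2.2) hr

variable [CompleteSpace H]

lemma designValue_nonneg (hc : 0 < c) (hw : 0 ≤ w) (S : Alive V n) :
    0 ≤ M.designValue c w S :=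
  Real.iSup_nonneg fun _ => invNormSq_nonneg hc hw _

lemma designValue_smul {r : ℝ} (hr : 0 < r) (hc : 0 < c) (hw : 0 ≤ w) (S : Alive V n) :
    M.designValue (r * c) (fun a => r * w a) S = M.designValue c w S / r := by
  simp only [designValue, invNormSq_smul hr hc hw, div_eq_mul_inv]
  exact (Real.iSup_mul_of_nonneg (inv_nonneg.2 hr.le) _).symm

lemma optValue_le (hc : 0 < c) (S : Alive V n) (hw : w ∈ stdSimplex ℝ (Arm V n)) :
    M.optValue c S ≤ M.designValue c w S :=
  ciInf_le (f := fun w : stdSimplex ℝ (Arm V n) => M.designValue c w S)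
    ⟨0, by rintro _ ⟨w, rfl⟩; exact designValue_nonneg hc w.2.1 S⟩ ⟨w, hw⟩

lemma IsOptAlloc.designValue_eq {S : Alive V n} (h : M.IsOptAlloc c S w) (hc : 0 < c) :
    M.designValue c w S = M.optValue c S := by
  refine le_antisymm ?_ (optValue_le hc S h.1)
  have : Nonempty (stdSimplex ℝ (Arm V n)) := ⟨⟨w, h.1⟩⟩
  exact le_ciInf fun w' => h.2 w'.2

lemma optValue_nonneg (hc : 0 < c) (S : Alive V n) : 0 ≤ M.optValue c S :=
  Real.iInf_nonneg fun w => designValue_nonneg hc w.2.1 S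

end Design

end Model

end CoopKernel

namespace CoopKernel

variable {d V n : ℕ} {Z : Type u} {H : Type v} [NormedAddCommGroup H] [InnerProductSpace ℝ H]

/-! ### Kernel ridge regression in feature space -/

section Estimator

variable (M : Model d V n Z H) (msg : Fin V → Message n)

lemma kernelMat_eq_gram :
    kernelMat M msg = Matrix.gram ℝ fun a : Arm V n => √((msg a.1 a.2).1 : ℝ) • M.phi a := by
  ext a b
  rw [Matrix.gram_apply, real_inner_smul_left, real_inner_smul_right, M.inner_phi, kernelMat,
    Matrix.of_apply, Real.sqrt_mul (Nat.cast_nonneg _), mul_assoc]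

lemma isUnit_kernelMat_add {c : ℝ} (hc : 0 < c) :
    IsUnit (kernelMat M msg + c • (1 : Matrix (Arm V n) (Arm V n) ℝ)) := by
  have h : (kernelMat M msg + c • (1 : Matrix (Arm V n) (Arm V n) ℝ)).PosDef := by
    rw [kernelMat_eq_gram]
    exact Matrix.PosDef.posSemidef_add (Matrix.posSemidef_gram ℝ _) (Matrix.PosDef.one.smul hc)
  exact h.isUnit

/-- Antisymmetry makes one-sided error bounds over ordered pairs sufficient. -/
lemma gapEst_swap (c : ℝ) (x x' : Arm V n) : gapEst M msg c x' x = -gapEst M msg c x x' := by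
  rw [gapEst, gapEst, ← neg_dotProduct, neg_sub]

variable [CompleteSpace H]

/-- The kernel form of the ridge regression estimate agrees with its form in the feature space. -/
lemma gapEst_eq_inner {c : ℝ} (hc : 0 < c) (x x' : Arm V n) :
    gapEst M msg c x x' = inner ℝ (M.phi x - M.phi x')
      ((M.designOp c fun a => ((msg a.1 a.2).1 : ℝ)).inverse
        (∑ a : Arm V n, (((msg a.1 a.2).1 : ℝ) * (msg a.1 a.2).2) • M.phi a)) := by
  set A := kernelMat M msg + c • (1 : Matrix (Arm V n) (Arm V n) ℝ) with hA
  set α := A⁻¹.mulVec (obsVec msg) with hα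
  have hAα : A.mulVec α = obsVec msg := by
    rw [hα, Matrix.mulVec_mulVec, Matrix.mul_nonsing_inv _
      ((Matrix.isUnit_iff_isUnit_det _).1 (isUnit_kernelMat_add M msg hc)), Matrix.one_mulVec]
  set z : H := ∑ a : Arm V n, (√((msg a.1 a.2).1 : ℝ) * α a) • M.phi a with hz
  have hinner : ∀ b : Arm V n, inner ℝ (M.phi b) z = kernelVec M msg b ⬝ᵥ α := fun b => by
    rw [hz, inner_sum, dotProduct]
    refine Finset.sum_congr rfl fun a _ => ?_
    rw [real_inner_smul_right, M.inner_phi, kernelVec]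
    ring
  have hop : M.designOp c (fun a => ((msg a.1 a.2).1 : ℝ)) z
      = ∑ a : Arm V n, (((msg a.1 a.2).1 : ℝ) * (msg a.1 a.2).2) • M.phi a := by
    rw [M.designOp_apply, hz, Finset.smul_sum, ← Finset.sum_add_distrib]
    refine Finset.sum_congr rfl fun a _ => ?_
    rw [smul_smul, ← add_smul, ← hz, hinner]
    congr 1
    -- Row `a` of the linear system for `α`, multiplied by `√N_a`, is the identity between the
    -- coefficients of `φ(a)`.
    have h := congrFun hAα a
    rw [hA, Matrix.add_mulVec, Pi.add_apply, Matrix.smul_mulVec, Matrix.one_mulVec, Pi.smul_apply,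
      obsVec, smul_eq_mul] at h
    have hs : √((msg a.1 a.2).1 : ℝ) * √((msg a.1 a.2).1 : ℝ) = (msg a.1 a.2).1 :=
      Real.mul_self_sqrt (Nat.cast_nonneg _)
    have hk : (kernelMat M msg).mulVec α a
        = √((msg a.1 a.2).1 : ℝ) * (kernelVec M msg a ⬝ᵥ α) := by
      rw [Matrix.mulVec, dotProduct, dotProduct, Finset.mul_sum]
      refine Finset.sum_congr rfl fun b _ => ?_
      rw [kernelMat, Matrix.of_apply, kernelVec, Real.sqrt_mul (Nat.cast_nonneg _)]
      ring
    rw [hk] at h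
    calc c * (√((msg a.1 a.2).1 : ℝ) * α a)
          + ((msg a.1 a.2).1 : ℝ) * (kernelVec M msg a ⬝ᵥ α)
        = √((msg a.1 a.2).1 : ℝ)
          * (√((msg a.1 a.2).1 : ℝ) * (kernelVec M msg a ⬝ᵥ α) + c * α a) := by
          linear_combination -(kernelVec M msg a ⬝ᵥ α) * hs
      _ = _ := by rw [h, ← mul_assoc, hs]
  rw [Model.inverse_eq_of_designOp_eq hc (fun a => Nat.cast_nonneg _) hop, inner_sub_left, hinner,
    hinner, gapEst, sub_dotProduct]

/-- The estimation error, split into the bias of the regularization and the noise. -/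
lemma gapEst_sub_reward {c : ℝ} (hc : 0 < c) (θ : H) (x x' : Arm V n) :
    gapEst M msg c x x' - (M.reward θ x - M.reward θ x')
      = ∑ a : Arm V n, ((msg a.1 a.2).1 : ℝ) * ((msg a.1 a.2).2 - M.reward θ a)
          * inner ℝ (M.phi x - M.phi x')
            ((M.designOp c fun a => ((msg a.1 a.2).1 : ℝ)).inverse (M.phi a))
        - c * inner ℝ (M.phi x - M.phi x')
            ((M.designOp c fun a => ((msg a.1 a.2).1 : ℝ)).inverse θ) := by
  have hw : (0 : Arm V n → ℝ) ≤ fun a => ((msg a.1 a.2).1 : ℝ) := fun a => Nat.cast_nonneg _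
  -- Applying `A⁻¹` to `A θ = c θ + ∑ N_a ⟨φ(a), θ⟩ φ(a)` writes `θ` in the same shape as the
  -- estimate; their difference is noise minus bias.
  have hθ := Model.inverse_eq_of_designOp_eq (M := M) hc hw (x := θ) rfl
  rw [M.designOp_apply, map_add, map_smul, map_sum] at hθ
  have hθ' := congrArg (fun y => inner ℝ (M.phi x - M.phi x') y) hθ
  simp only [inner_add_right, inner_sum, map_smul, real_inner_smul_right] at hθ'
  have hr : M.reward θ x - M.reward θ x' = inner ℝ (M.phi x - M.phi x') θ := by
    rw [M.reward_eq_inner, M.reward_eq_inner, inner_sub_left]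
  rw [gapEst_eq_inner M msg hc, hr, ← hθ', map_sum, inner_sum]
  simp only [map_smul, real_inner_smul_right, ← M.reward_eq_inner]
  simp only [mul_sub, sub_mul, Finset.sum_sub_distrib]
  ring

end Estimator

/-! ### Sample counts and averages in the messages -/

section Message

lemma count_agentSeq (s : List (Arm V n)) (v : Fin V) (i : Fin n) :
    (agentSeq s v).count i = s.count (v, i) := by
  induction s with
  | nil => rfl
  | cons a s ih =>
    obtain ⟨v', i'⟩ := a
    by_cases h : v' = v
    · subst h
      simp [agentSeq, List.count_cons] at ih ⊢
      rw [ih]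
    · simp [agentSeq, h] at ih ⊢
      exact ih

lemma sum_length_agentSeq (s : List (Arm V n)) : ∑ v, (agentSeq s v).length = s.length := by
  induction s with
  | nil => simp [agentSeq]
  | cons a s ih =>
    have h : ∀ v, (agentSeq (a :: s) v).length
        = (agentSeq s v).length + if a.1 = v then 1 else 0 := fun v => by
      by_cases h : a.1 = v <;> simp [agentSeq, h]
    simp [h, Finset.sum_add_distrib, ih]

lemma sum_get_eq_sum_count {R : Type*} [CommSemiring R] (s : List (Fin n)) (g : Fin n → R) :
    ∑ m : Fin s.length, g (s.get m) = ∑ i, (s.count i : R) * g i := by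
  have h : ∑ m : Fin s.length, g (s.get m) = (s.map g).sum := by
    rw [← List.sum_ofFn]
    congr 1
    simp [List.ofFn_getElem_eq_map]
  rw [h, Finset.sum_list_map_count, Finset.sum_subset (Finset.subset_univ _)]
  · simp
  · intro i _ hi
    rw [List.mem_toFinset] at hi
    simp [List.count_eq_zero.2 hi]

/-- Weighted by the number of samples, the deviation of the average observation of an arm from the
expected reward is the sum of the noise terms. -/
lemma message_mul_sub (f : Fin n → ℝ) (e : ℕ → Fin n → ℝ) (c : ℕ) (s : List (Fin n))
    (i : Fin n) :
    ((message (fun τ i => f i + e τ i) c s i).1 : ℝ)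
        * ((message (fun τ i => f i + e τ i) c s i).2 - f i)
      = ∑ m : Fin s.length, if s.get m = i then e (c + m) i else 0 := by
  have hcount : (∑ m : Fin s.length, if s.get m = i then f i else 0) = s.count i * f i := by
    rw [sum_get_eq_sum_count s fun j => if j = i then f i else 0]
    simp
  have hsplit : (∑ m : Fin s.length, if s.get m = i then f i + e (c + m) i else 0)
      = s.count i * f i + ∑ m : Fin s.length, if s.get m = i then e (c + m) i else 0 := by
    rw [← hcount, ← Finset.sum_add_distrib]
    exact Finset.sum_congr rfl fun m _ => by split_ifs <;> simp
  simp only [message]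
  rw [hsplit]
  by_cases h : s.count i = 0
  -- For an unsampled arm the average is `0 / 0 = 0`, but its weight is zero.
  · have h0 : ∀ m : Fin s.length, s.get m ≠ i := fun m hm =>
      List.count_eq_zero.1 h (hm ▸ List.get_mem s m)
    rw [Finset.sum_eq_zero fun m _ => if_neg (h0 m), h]
    simp
  · have : (s.count i : ℝ) ≠ 0 := Nat.cast_ne_zero.2 h
    field_simp
    ring

end Message

end CoopKernel

namespace CoopKernel

variable {d V n : ℕ} {Z : Type u} {H : Type v} [NormedAddCommGroup H] [InnerProductSpace ℝ H]

/-- States store no real-valued rewards, so there are countably many; the discrete σ-algebra allows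
summing over initial states of a phase. -/
instance : MeasurableSpace (State V n) := ⊤

instance : DiscreteMeasurableSpace (State V n) := ⟨fun _ => trivial⟩

instance : Countable (State V n) :=
  Function.Injective.countable (f := fun s : State V n => (s.phase, s.alive, s.clock, s.rounds))
    fun s s' h => by
      cases s; cases s'; simpa using h

/-! ### Which rewards an execution reads -/

section Dependence

variable (M : Model d V n Z H) (cfg : Config V n)

lemma run_succ (y : Fin V → ℕ → Fin n → ℝ) (k : ℕ) :
    run M cfg y (k + 1) = step M cfg y (run M cfg y k) :=
  Function.iterate_succ_apply' _ _ _

lemma run_zero (y : Fin V → ℕ → Fin n → ℝ) : run M cfg y 0 = State.init V n := rfl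

lemma run_phase (y : Fin V → ℕ → Fin n → ℝ) (k : ℕ) : (run M cfg y k).phase = k + 1 := by
  induction k with
  | zero => rfl
  | succ k ih => rw [run_succ, step, ih]

lemma run_rounds (y : Fin V → ℕ → Fin n → ℝ) (k : ℕ) : (run M cfg y k).rounds = k := by
  induction k with
  | zero => rfl
  | succ k ih => rw [run_succ, step, ih]

lemma message_congr {y y' : ℕ → Fin n → ℝ} {c : ℕ} {s : List (Fin n)}
    (h : ∀ τ, c ≤ τ → τ < c + s.length → y τ = y' τ) : message y c s = message y' c s := by
  funext i
  simp only [message]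
  congr 2
  exact Finset.sum_congr rfl fun m _ => by rw [h (c + m) (Nat.le_add_right _ _) (by omega)]

lemma step_clock (y : Fin V → ℕ → Fin n → ℝ) (s : State V n) (v : Fin V) :
    (step M cfg y s).clock v = s.clock v + (agentSeq (phaseSeq M cfg s) v).length := rfl

lemma step_congr {y y' : Fin V → ℕ → Fin n → ℝ} {s : State V n}
    (h : ∀ v, ∀ τ < (step M cfg y s).clock v, y v τ = y' v τ) :
    step M cfg y s = step M cfg y' s := by
  have hm : phaseMessages M cfg y s = phaseMessages M cfg y' s :=
    funext fun v => message_congr fun τ _ hτ => h v τ (by rwa [step_clock])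
  simp only [step, hm]

/-- The clocks depend on the rewards, but agreement before the clocks of one run forces both runs to
make the same choices, phase by phase. -/
lemma run_congr {y y' : Fin V → ℕ → Fin n → ℝ} (k : ℕ)
    (h : ∀ v, ∀ τ < (run M cfg y k).clock v, y v τ = y' v τ) :
    run M cfg y k = run M cfg y' k := by
  induction k with
  | zero => rw [run_zero, run_zero]
  | succ k ih =>
    simp only [run_succ] at h ⊢
    have hk : run M cfg y k = run M cfg y' k :=
      ih fun v τ hτ => h v τ (by rw [step_clock]; exact hτ.trans_le (Nat.le_add_right _ _))
    rw [← hk]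
    exact step_congr M cfg h

/-- The entries of a reward table before the clocks `c`. -/
def before (c : Fin V → ℕ) (y : Fin V → ℕ → Fin n → ℝ) : Fin V → ℕ → Fin n → ℝ :=
  fun v τ => if τ < c v then y v τ else 0

/-- The entries of a reward table from the clocks `c` on. -/
def after (c : Fin V → ℕ) (y : Fin V → ℕ → Fin n → ℝ) : Fin V → ℕ → Fin n → ℝ :=
  fun v τ => if c v ≤ τ then y v τ else 0

/-- Expresses a reached state through rewards before deterministic clocks, namely those of `s`,
although the clocks of the run are random. -/
lemma run_before_eq_iff (y : Fin V → ℕ → Fin n → ℝ) (k : ℕ) (s : State V n) :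
    run M cfg (before s.clock y) k = s ↔ run M cfg y k = s := by
  constructor
  · intro h
    rw [← h]
    refine (run_congr M cfg k fun v τ hτ => ?_).symm
    rw [h] at hτ
    simp [before, hτ]
  · intro h
    conv_rhs => rw [← h]
    refine (run_congr M cfg k fun v τ hτ => ?_).symm
    rw [h] at hτ
    simp [before, hτ]

lemma phaseMessages_after (y : Fin V → ℕ → Fin n → ℝ) (s : State V n) :
    phaseMessages M cfg (after s.clock y) s = phaseMessages M cfg y s :=
  funext fun v => message_congr fun τ hτ _ => by simp [after, hτ]

/-- In the phase that starts in state `s`, some estimated gap exceeds the true gap by `2 ^ (-t)`. -/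
def Inaccurate (θ : H) (s : State V n) (y : Fin V → ℕ → Fin n → ℝ) : Prop :=
  ∃ v, ∃ i ∈ s.alive v, ∃ j ∈ s.alive v,
    M.reward θ (v, i) - M.reward θ (v, j) + (1 / 2 : ℝ) ^ s.phase
      ≤ gapEst M (phaseMessages M cfg y s)
        (numSamples M cfg s.phase s.alive * cfg.ξ s.phase) (v, i) (v, j)

lemma inaccurate_after_iff (θ : H) (s : State V n) (y : Fin V → ℕ → Fin n → ℝ) :
    Inaccurate M cfg θ s (after s.clock y) ↔ Inaccurate M cfg θ s y := by
  rw [Inaccurate, phaseMessages_after, Inaccurate]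

lemma measurable_gapEst_phaseMessages (s : State V n) (c : ℝ) (x x' : Arm V n) :
    Measurable fun y : Fin V → ℕ → Fin n → ℝ => gapEst M (phaseMessages M cfg y s) c x x' := by
  have hobs : Measurable fun y : Fin V → ℕ → Fin n → ℝ => obsVec (phaseMessages M cfg y s) := by
    refine measurable_pi_lambda _ fun a => ?_
    simp only [obsVec, phaseMessages, message]
    refine Measurable.const_mul (Measurable.div_const ?_ _) _
    refine Finset.measurable_sum _ fun m _ => ?_
    split_ifs
    · fun_prop
    · exact measurable_const
  -- The counts are fixed by `s`, so the kernel vectors and the matrix can be taken from the zero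
  -- table; only the observations vary.
  have heq : ∀ y : Fin V → ℕ → Fin n → ℝ, gapEst M (phaseMessages M cfg y s) c x x'
      = (kernelVec M (phaseMessages M cfg 0 s) x - kernelVec M (phaseMessages M cfg 0 s) x') ⬝ᵥ
        ((kernelMat M (phaseMessages M cfg 0 s)
          + c • (1 : Matrix (Arm V n) (Arm V n) ℝ))⁻¹.mulVec
            (obsVec (phaseMessages M cfg y s))) := fun y => rfl
  simp only [heq, Matrix.mulVec, dotProduct]
  refine Finset.measurable_sum _ fun a _ => Measurable.const_mul ?_ _
  exact Finset.measurable_sum _ fun b _ => ((measurable_pi_apply b).comp hobs).const_mul _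

lemma measurableSet_inaccurate (θ : H) (s : State V n) :
    MeasurableSet {y | Inaccurate M cfg θ s y} := by
  simp only [Inaccurate, Set.ofPred_exists, Set.ofPred_and]
  refine MeasurableSet.iUnion fun v => MeasurableSet.iUnion fun i =>
    (MeasurableSet.const _).inter (MeasurableSet.iUnion fun j => (MeasurableSet.const _).inter ?_)
  exact measurableSet_le measurable_const (measurable_gapEst_phaseMessages M cfg s _ _ _)

lemma measurable_step (s : State V n) : Measurable fun y => step M cfg y s := by
  classical
  have htab : Measurable fun (y : Fin V → ℕ → Fin n → ℝ) (v : Fin V) (j i : Fin n) =>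
      (1 / 2 : ℝ) ^ s.phase ≤ gapEst M (phaseMessages M cfg y s)
        (numSamples M cfg s.phase s.alive * cfg.ξ s.phase) (v, j) (v, i) := by
    refine measurable_pi_lambda _ fun v => measurable_pi_lambda _ fun j =>
      measurable_pi_lambda _ fun i => measurableSet_setOfPred.1 ?_
    exact measurableSet_le measurable_const (measurable_gapEst_phaseMessages M cfg s _ _ _)
  -- The new state depends on the rewards only through finitely many truth values of threshold
  -- comparisons.
  let G : (Fin V → Fin n → Fin n → Prop) → State V n := fun T =>
    ⟨s.phase + 1, fun v => s.alive v \ (s.alive v).filter fun i => ∃ j ∈ s.alive v, T v j i,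
      fun v => s.clock v + (agentSeq (phaseSeq M cfg s) v).length, s.rounds + 1⟩
  have hG : Measurable G := Measurable.of_discrete
  convert hG.comp htab using 2 with y
  simp only [step, G, Function.comp]
  congr 1
  funext v
  unfold eliminate
  congr!

lemma measurable_run (k : ℕ) : Measurable fun y => run M cfg y k := by
  induction k with
  | zero => exact measurable_const
  | succ k ih =>
    simp only [run_succ]
    have h : Measurable fun p : (Fin V → ℕ → Fin n → ℝ) × State V n => step M cfg p.1 p.2 :=
      measurable_from_prod_countable_left fun s => measurable_step M cfg s
    exact h.comp (measurable_id.prodMk ih)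

end Dependence

/-! ### Independence of past and future noise -/

section Independence

variable (M : Model d V n Z H) (cfg : Config V n) (θ : H)
  {Ω : Type w} {η : Fin V → ℕ → Fin n → Ω → ℝ}

lemma measurable_restrict_rewardTable {m : MeasurableSpace Ω} (P : Fin V → ℕ → Prop)
    [∀ v τ, Decidable (P v τ)]
    (h : ∀ v τ, P v τ → Measurable[m] fun ω (i : Fin n) => η v τ i ω) :
    Measurable[m] fun ω v τ => if P v τ then rewardTable M θ η ω v τ else 0 := by
  refine measurable_pi_lambda _ fun v => measurable_pi_lambda _ fun τ => ?_
  by_cases hP : P v τ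
  · simp only [hP, if_true]
    refine measurable_pi_lambda _ fun i => ?_
    exact ((measurable_pi_apply i).comp (h v τ hP)).const_add _
  · simp only [hP, if_false]
    exact measurable_const

variable [MeasurableSpace Ω] {μ : Measure Ω}

/-- The noise of a phase is independent of the event that the phase starts in a given state. -/
lemma measure_run_eq_inter_inaccurate (hη : ∀ v τ i, Measurable (η v τ i))
    (hind : iIndepFun (fun (p : Fin V × ℕ) (ω : Ω) (i : Fin n) => η p.1 p.2 i ω) μ)
    (k : ℕ) (s : State V n) :
    μ ({ω | run M cfg (rewardTable M θ η ω) k = s}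
        ∩ {ω | Inaccurate M cfg θ s (rewardTable M θ η ω)})
      = μ {ω | run M cfg (rewardTable M θ η ω) k = s}
        * μ {ω | Inaccurate M cfg θ s (rewardTable M θ η ω)} := by
  set m : Fin V × ℕ → MeasurableSpace Ω := fun p =>
    MeasurableSpace.comap (fun ω (i : Fin n) => η p.1 p.2 i ω) inferInstance with hm
  have hle : ∀ p, m p ≤ ‹MeasurableSpace Ω› := fun p =>
    (measurable_pi_lambda _ fun i => hη p.1 p.2 i).comap_le
  -- The clocks of the fixed state `s` split the sample indices into past and future; each index
  -- carries its whole noise vector, so independence across arms is not needed.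
  set S : Set (Fin V × ℕ) := {p | p.2 < s.clock p.1} with hS
  have hmeas : ∀ T : Set (Fin V × ℕ), ∀ v τ, (v, τ) ∈ T →
      Measurable[⨆ p ∈ T, m p] fun ω (i : Fin n) => η v τ i ω := fun T v τ h =>
    Measurable.mono (comap_measurable _) (le_iSup₂ (f := fun p (_ : p ∈ T) => m p) (v, τ) h) le_rfl
  have hindep : Indep (⨆ p ∈ S, m p) (⨆ p ∈ Sᶜ, m p) μ :=
    indep_iSup_of_disjoint hle hind.iIndep disjoint_compl_right
  refine (Indep_iff _ _ μ).1 hindep _ _ ?_ ?_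
  · have h := measurable_restrict_rewardTable M θ (η := η) (m := ⨆ p ∈ S, m p)
      (fun v τ => τ < s.clock v) fun v τ h => hmeas S v τ h
    have h2 := (measurable_run M cfg k).comp h (measurableSet_singleton s)
    convert h2 using 1
    ext ω
    exact (run_before_eq_iff M cfg _ k s).symm
  · have h := measurable_restrict_rewardTable M θ (η := η) (m := ⨆ p ∈ Sᶜ, m p)
      (fun v τ => s.clock v ≤ τ) fun v τ h => hmeas Sᶜ v τ (by simpa [hS] using h)
    have h2 := h (measurableSet_inaccurate M cfg θ s)
    convert h2 using 1
    ext ω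
    exact (inaccurate_after_iff M cfg θ s _).symm

/-- A bound on the failure probability of a phase which holds for all its possible initial states
holds for the execution. -/
lemma measure_run_inaccurate_le [IsProbabilityMeasure μ] (hη : ∀ v τ i, Measurable (η v τ i))
    (hind : iIndepFun (fun (p : Fin V × ℕ) (ω : Ω) (i : Fin n) => η p.1 p.2 i ω) μ)
    (k : ℕ) (P : State V n → Prop) (q : ENNReal)
    (hq : ∀ s, s.phase = k + 1 → P s →
      μ {ω | Inaccurate M cfg θ s (rewardTable M θ η ω)} ≤ q) :
    μ {ω | P (run M cfg (rewardTable M θ η ω) k) ∧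
      Inaccurate M cfg θ (run M cfg (rewardTable M θ η ω) k) (rewardTable M θ η ω)} ≤ q := by
  have htab : Measurable fun ω => rewardTable M θ η ω :=
    measurable_pi_lambda _ fun v => measurable_pi_lambda _ fun τ => measurable_pi_lambda _ fun i =>
      (hη v τ i).const_add _
  have hrun : Measurable fun ω => run M cfg (rewardTable M θ η ω) k :=
    (measurable_run M cfg k).comp htab
  calc μ {ω | P (run M cfg (rewardTable M θ η ω) k) ∧
        Inaccurate M cfg θ (run M cfg (rewardTable M θ η ω) k) (rewardTable M θ η ω)}
      ≤ μ (⋃ s : State V n, {ω | run M cfg (rewardTable M θ η ω) k = s ∧ P s ∧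
          Inaccurate M cfg θ s (rewardTable M θ η ω)}) := by
        refine measure_mono fun ω hω => Set.mem_iUnion.2 ⟨_, rfl, hω⟩
    _ ≤ ∑' s : State V n, μ {ω | run M cfg (rewardTable M θ η ω) k = s ∧ P s ∧
          Inaccurate M cfg θ s (rewardTable M θ η ω)} := measure_iUnion_le _
    _ ≤ ∑' s : State V n, μ ((fun ω => run M cfg (rewardTable M θ η ω) k) ⁻¹' {s}) * q := by
        refine ENNReal.tsum_le_tsum fun s => ?_
        -- A state with the wrong phase or violating `P` contributes the empty event.
        by_cases hs : s.phase = k + 1 ∧ P s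
        · refine (measure_mono fun ω hω => ?_).trans
            ((measure_run_eq_inter_inaccurate M cfg θ hη hind k s).le.trans
              (mul_le_mul_right (hq s hs.1 hs.2) _))
          exact ⟨hω.1, hω.2.2⟩
        · have : {ω | run M cfg (rewardTable M θ η ω) k = s ∧ P s ∧
              Inaccurate M cfg θ s (rewardTable M θ η ω)} = ∅ := by
            refine Set.eq_empty_of_forall_notMem fun ω hω => hs ⟨?_, hω.2.1⟩
            rw [← hω.1, run_phase]
          rw [this, measure_empty]
          exact zero_le
    _ = q := by
        have huniv : ∑' s : State V n, μ ((fun ω => run M cfg (rewardTable M θ η ω) k) ⁻¹' {s})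
            = 1 := by
          rw [← measure_iUnion]
          · rw [← Set.preimage_iUnion, Set.iUnion_of_singleton, Set.preimage_univ, measure_univ]
          · exact fun s s' h => Disjoint.preimage _ (Set.disjoint_singleton.2 h)
          · exact fun s => hrun (measurableSet_singleton s)
        rw [ENNReal.tsum_mul_right, huniv, one_mul]

end Independence

end CoopKernel

noncomputable section

namespace CoopKernel

variable {d V n : ℕ} {Z : Type u} {H : Type v} [NormedAddCommGroup H] [InnerProductSpace ℝ H]

/-! ### Sub-Gaussian tails and the error of one phase -/

section Noise

variable {Ω : Type w} [MeasurableSpace Ω] {μ : Measure Ω} {η : Fin V → ℕ → Fin n → Ω → ℝ}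

lemma _root_.ProbabilityTheory.HasSubgaussianMGF.mono_param {X : Ω → ℝ} {c c' : NNReal}
    (h : HasSubgaussianMGF X c μ) (hc : c ≤ c') : HasSubgaussianMGF X c' μ :=
  ⟨h.integrable_exp_mul, fun t => (h.mgf_le t).trans (Real.exp_le_exp.2 (by gcongr))⟩

/-- Tail bound for weighted sums of distinct noise variables. -/
lemma measure_sum_noise_ge_le [IsProbabilityMeasure μ]
    (hsub : ∀ v τ i, HasSubgaussianMGF (η v τ i) 1 μ)
    (hind : iIndepFun (fun (p : Fin V × ℕ) (ω : Ω) (i : Fin n) => η p.1 p.2 i ω) μ)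
    {ι : Type*} [Fintype ι] {e : ι → Fin V × ℕ} (he : Function.Injective e) (f : ι → Fin n)
    (g : ι → ℝ) {σ2 r : ℝ} (hσ : ∑ k, g k ^ 2 ≤ σ2) (hr : 0 ≤ r) :
    μ.real {ω | r ≤ ∑ k, g k * η (e k).1 (e k).2 (f k) ω} ≤ Real.exp (-r ^ 2 / (2 * σ2)) := by
  have hσ0 : 0 ≤ σ2 := (Finset.sum_nonneg fun k _ => sq_nonneg (g k)).trans hσ
  have hi : iIndepFun (fun k ω => g k * η (e k).1 (e k).2 (f k) ω) μ :=
    (hind.precomp he).comp (fun k x => g k * x (f k))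
      fun k => by fun_prop
  have hs := HasSubgaussianMGF.sum_of_iIndepFun hi (s := Finset.univ)
    fun k _ => (hsub (e k).1 (e k).2 (f k)).const_mul (g k)
  have hle : (∑ k, NNReal.mk (g k ^ 2) (sq_nonneg (g k)) * 1) ≤ NNReal.mk σ2 hσ0 := by
    rw [← NNReal.coe_le_coe, NNReal.coe_sum]
    simpa using hσ
  exact (hs.mono_param hle).measure_ge_le hr

end Noise

section PhaseError

variable (M : Model d V n Z H) (cfg : Config V n) (θ : H)

/-- The number of samples of each arm in the phase that starts in state `s`. -/
def phaseCount (s : State V n) (a : Arm V n) : ℝ := (phaseSeq M cfg s).count a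

lemma phaseMessages_count (y : Fin V → ℕ → Fin n → ℝ) (s : State V n) :
    (fun a : Arm V n => ((phaseMessages M cfg y s a.1 a.2).1 : ℝ)) = phaseCount M cfg s :=
  funext fun a => congrArg Nat.cast (count_agentSeq (phaseSeq M cfg s) a.1 a.2)

/-- The coefficient of the samples of arm `a` in the estimated gap between `x` and `x'`. -/
def noiseCoeff (s : State V n) (c : ℝ) (x x' a : Arm V n) : ℝ :=
  inner ℝ (M.phi x - M.phi x') ((M.designOp c (phaseCount M cfg s)).inverse (M.phi a))

/-- The arm of a sample of the phase that starts in state `s`. -/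
def sampleArm (s : State V n) (p : Σ v, Fin (agentSeq (phaseSeq M cfg s) v).length) : Arm V n :=
  (p.1, (agentSeq (phaseSeq M cfg s) p.1).get p.2)

lemma sum_sampleArm (s : State V n) (g : Arm V n → ℝ) :
    ∑ p, g (sampleArm M cfg s p) = ∑ a, phaseCount M cfg s a * g a := by
  rw [Fintype.sum_sigma, Fintype.sum_prod_type]
  refine Finset.sum_congr rfl fun v _ => ?_
  simp only [sampleArm]
  rw [sum_get_eq_sum_count (agentSeq (phaseSeq M cfg s) v) fun i => g (v, i)]
  simp only [phaseCount, count_agentSeq]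

variable [CompleteSpace H]

/-- Regroups the noise from arms to individual samples, so that the terms carry distinct indices
`(v, τ)` and are independent. -/
lemma gapEst_phase {Ω : Type w} (η : Fin V → ℕ → Fin n → Ω → ℝ) (ω : Ω) (s : State V n) {c : ℝ}
    (hc : 0 < c) (x x' : Arm V n) :
    gapEst M (phaseMessages M cfg (rewardTable M θ η ω) s) c x x'
        - (M.reward θ x - M.reward θ x')
      = ∑ p : Σ v, Fin (agentSeq (phaseSeq M cfg s) v).length,
          noiseCoeff M cfg s c x x' (sampleArm M cfg s p)
            * η p.1 (s.clock p.1 + p.2) (sampleArm M cfg s p).2 ω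
        - c * inner ℝ (M.phi x - M.phi x')
            ((M.designOp c (phaseCount M cfg s)).inverse θ) := by
  rw [gapEst_sub_reward M _ hc, phaseMessages_count, Fintype.sum_prod_type, Fintype.sum_sigma]
  congr 1
  refine Finset.sum_congr rfl fun v _ => ?_
  have h : ∀ i, ((phaseMessages M cfg (rewardTable M θ η ω) s v i).1 : ℝ)
        * ((phaseMessages M cfg (rewardTable M θ η ω) s v i).2 - M.reward θ (v, i))
      = ∑ m : Fin (agentSeq (phaseSeq M cfg s) v).length,
        if (agentSeq (phaseSeq M cfg s) v).get m = i then η v (s.clock v + m) i ω else 0 :=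
    fun i => message_mul_sub (fun i => M.reward θ (v, i)) (fun τ i => η v τ i ω) _ _ i
  simp only [h, Finset.sum_mul]
  rw [Finset.sum_comm]
  refine Finset.sum_congr rfl fun m _ => ?_
  simp only [ite_mul, zero_mul, Finset.sum_ite_eq, Finset.mem_univ, if_true]
  rw [mul_comm]
  rfl

lemma sum_noiseCoeff_sq_le (s : State V n) {c : ℝ} (hc : 0 < c) (x x' : Arm V n) :
    ∑ p, noiseCoeff M cfg s c x x' (sampleArm M cfg s p) ^ 2
      ≤ M.invNormSq c (phaseCount M cfg s) (M.phi x - M.phi x') := by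
  rw [sum_sampleArm M cfg s fun a => noiseCoeff M cfg s c x x' a ^ 2]
  exact Model.sum_weight_inverse_sq_le hc (fun a => Nat.cast_nonneg _) _

end PhaseError

/-! ### Consequences of the regularization condition -/

section Regularization

variable {M : Model d V n Z H}

lemma uniform_mem_stdSimplex (hV : 1 ≤ V) (hn : 1 ≤ n) :
    (fun _ => 1 / ((n : ℝ) * V)) ∈ stdSimplex ℝ (Arm V n) := by
  have hV' : (0 : ℝ) < V := by exact_mod_cast hV
  have hn' : (0 : ℝ) < n := by exact_mod_cast hn
  refine ⟨fun _ => by positivity, ?_⟩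
  simp only [Finset.sum_const, Finset.card_univ, Fintype.card_prod, Fintype.card_fin, nsmul_eq_mul,
    Nat.cast_mul]
  field_simp

variable [CompleteSpace H]

lemma Model.RegCondition.mul_invNormSq_le {ε B ξ : ℝ} {t : ℕ}
    (h : M.RegCondition ε B t ξ) (hξ : 0 < ξ) (v : Fin V) (i j : Fin n) :
    ξ * M.invNormSq ξ (fun _ => 1 / ((n : ℝ) * V)) (M.phi (v, i) - M.phi (v, j))
      ≤ (1 / ((1 + ε) * B * 2 ^ (t + 1))) ^ 2 := by
  have hw : (0 : Arm V n → ℝ) ≤ fun _ => 1 / ((n : ℝ) * V) := fun _ => by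
    simp only [Pi.zero_apply]; positivity
  have hq := Model.invNormSq_nonneg (M := M) hξ hw (M.phi (v, i) - M.phi (v, j))
  have h1 := le_ciSup (f := fun q : Fin V × Fin n × Fin n =>
    √(M.invNormSq ξ (fun _ => 1 / ((n : ℝ) * V)) (M.phi (q.1, q.2.1) - M.phi (q.1, q.2.2))))
    (Set.finite_range _).bddAbove (v, i, j)
  have h2 := (mul_le_mul_of_nonneg_left h1 (Real.sqrt_nonneg ξ)).trans h
  rw [← Real.sqrt_mul hξ.le] at h2
  calc _ = √(ξ * M.invNormSq ξ (fun _ => 1 / ((n : ℝ) * V))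
        (M.phi (v, i) - M.phi (v, j))) ^ 2 := (Real.sq_sqrt (mul_nonneg hξ.le hq)).symm
    _ ≤ _ := by gcongr

/-- The condition concerns only the uniform allocation, but that allocation is feasible and the
optimum is no larger. -/
lemma Model.RegCondition.mul_optValue_le {ε B ξ : ℝ} {t : ℕ} (h : M.RegCondition ε B t ξ)
    (hξ : 0 < ξ) (hV : 1 ≤ V) (hn : 1 ≤ n) (S : Alive V n) :
    ξ * M.optValue ξ S ≤ (1 / ((1 + ε) * B * 2 ^ (t + 1))) ^ 2 := by
  have h1 := Model.optValue_le (M := M) hξ S (uniform_mem_stdSimplex hV hn)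
  refine (mul_le_mul_of_nonneg_left h1 hξ.le).trans ?_
  rw [← le_div_iff₀' hξ]
  refine Model.designValue_le (by positivity) fun v i _ j _ => ?_
  rw [le_div_iff₀' hξ]
  exact h.mul_invNormSq_le hξ v i j

end Regularization

/-! ### Failure probability of one phase -/

section PhaseFailure

variable {M : Model d V n Z H} {cfg : Config V n} {B : ℝ}

lemma Config.Valid.one_lt_log_arg (hval : cfg.Valid M B) (hV : 1 ≤ V) (hn : 2 ≤ n) {t : ℕ}
    (ht : 1 ≤ t) : 1 < 2 * (n : ℝ) ^ 2 * V / cfg.deltaAt t := by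
  have hδ := hval.δ_pos
  have hδ1 := hval.δ_lt_one
  have hV' : (1 : ℝ) ≤ V := by exact_mod_cast hV
  have hn' : (2 : ℝ) ≤ n := by exact_mod_cast hn
  have ht' : (1 : ℝ) ≤ t := by exact_mod_cast ht
  have hdt : cfg.deltaAt t ≤ 1 := by
    rw [Config.deltaAt, div_le_one (by positivity)]
    nlinarith
  have hdp : 0 < cfg.deltaAt t := by rw [Config.deltaAt]; positivity
  rw [one_lt_div hdp]
  have : (1 : ℝ) ≤ (n : ℝ) ^ 2 * V := one_le_mul_of_one_le_of_one_le (by nlinarith) hV'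
  nlinarith

/-- The state satisfies the requirements under which the estimates of its phase are accurate. -/
structure State.Sound (M : Model d V n Z H) (cfg : Config V n) (s : State V n) : Prop where
  one_le_phase : 1 ≤ s.phase
  optValue_pos : 0 < M.optValue (cfg.ξ s.phase) s.alive
  rounding : M.IsRounding cfg.ε (cfg.ξ s.phase) s.alive (phaseAlloc cfg s)
      (numSamples M cfg s.phase s.alive) (phaseSeq M cfg s)

variable {s : State V n}

lemma numSamples_pos (hval : cfg.Valid M B) (hV : 1 ≤ V) (hn : 2 ≤ n) (hs : s.Sound M cfg) :
    0 < numSamples M cfg s.phase s.alive := by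
  have h1 := hs.optValue_pos
  have h2 := Real.log_pos (hval.one_lt_log_arg hV hn hs.one_le_phase)
  have h3 := hval.ε_pos
  exact Nat.ceil_pos.2 (by positivity)

variable [CompleteSpace H]

/-- The rounding guarantee compares with `N λ*` and regularization `N ξ`; scaling both by `N`
divides the design value by `N`. -/
lemma invNormSq_phase_le (hval : cfg.Valid M B) (hV : 1 ≤ V) (hn : 2 ≤ n) (hs : s.Sound M cfg)
    {v : Fin V} {i j : Fin n} (hi : i ∈ s.alive v) (hj : j ∈ s.alive v) :
    M.invNormSq (numSamples M cfg s.phase s.alive * cfg.ξ s.phase) (phaseCount M cfg s)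
        (M.phi (v, i) - M.phi (v, j))
      ≤ (1 + cfg.ε) * M.optValue (cfg.ξ s.phase) s.alive
        / numSamples M cfg s.phase s.alive := by
  have hN : (0 : ℝ) < numSamples M cfg s.phase s.alive :=
    Nat.cast_pos.2 (numSamples_pos hval hV hn hs)
  have hξ := hval.ξ_pos _ hs.one_le_phase
  have hopt := hval.solver_opt _ hs.one_le_phase s.alive
  refine (Model.invNormSq_le_designValue s.alive hi hj).trans (hs.rounding.2.trans_eq ?_)
  rw [phaseAlloc, Model.designValue_smul hN hξ hopt.1.1, hopt.designValue_eq hξ, mul_div_assoc]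

/-- The factor `N` cancels between regularization and design norm, leaving `(1 + ε) ξ_t ρ_t`, which
the regularization condition controls. -/
lemma bias_phase_le (hB : 0 < B) {θ : H} (hθ : ‖θ‖ ≤ B) (hval : cfg.Valid M B) (hV : 1 ≤ V)
    (hn : 2 ≤ n) (hs : s.Sound M cfg) {v : Fin V} {i j : Fin n} (hi : i ∈ s.alive v)
    (hj : j ∈ s.alive v) :
    (numSamples M cfg s.phase s.alive * cfg.ξ s.phase)
      * |inner ℝ (M.phi (v, i) - M.phi (v, j))
          ((M.designOp (numSamples M cfg s.phase s.alive * cfg.ξ s.phase)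
            (phaseCount M cfg s)).inverse θ)| ≤ (1 / 2 : ℝ) ^ s.phase / 2 := by
  have hN : (0 : ℝ) < numSamples M cfg s.phase s.alive :=
    Nat.cast_pos.2 (numSamples_pos hval hV hn hs)
  have hξ := hval.ξ_pos _ hs.one_le_phase
  have hε := hval.ε_pos
  have hq := invNormSq_phase_le hval hV hn hs hi hj
  have hreg := (hval.ξ_cond _ hs.one_le_phase).mul_optValue_le hξ hV (one_le_two.trans hn) s.alive
  refine (Model.mul_abs_inner_inverse_le hθ (mul_pos hN hξ)
    (fun a => Nat.cast_nonneg _) _).trans ?_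
  set N : ℝ := ((numSamples M cfg s.phase s.alive : ℕ) : ℝ)
  set ρ := M.optValue (cfg.ξ s.phase) s.alive
  have h1 : N * cfg.ξ s.phase * M.invNormSq (N * cfg.ξ s.phase) (phaseCount M cfg s)
      (M.phi (v, i) - M.phi (v, j)) ≤ (1 / (B * 2 ^ (s.phase + 1))) ^ 2 := by
    calc N * cfg.ξ s.phase * M.invNormSq (N * cfg.ξ s.phase) (phaseCount M cfg s)
          (M.phi (v, i) - M.phi (v, j))
        ≤ N * cfg.ξ s.phase * ((1 + cfg.ε) * ρ / N) := by gcongr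
      _ = (1 + cfg.ε) * (cfg.ξ s.phase * ρ) := by field_simp
      _ ≤ (1 + cfg.ε) * (1 / ((1 + cfg.ε) * B * 2 ^ (s.phase + 1))) ^ 2 := by gcongr
      _ = (1 / (1 + cfg.ε)) * (1 / (B * 2 ^ (s.phase + 1))) ^ 2 := by field_simp
      _ ≤ 1 * (1 / (B * 2 ^ (s.phase + 1))) ^ 2 := by
        gcongr
        rw [div_le_one (by positivity)]
        linarith
      _ = _ := one_mul _
  calc B * √_ ≤ B * √((1 / (B * 2 ^ (s.phase + 1))) ^ 2) := by gcongr; exact h1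
    _ = B * (1 / (B * 2 ^ (s.phase + 1))) := by rw [Real.sqrt_sq (by positivity)]
    _ = (1 / 2 : ℝ) ^ s.phase / 2 := by
      rw [div_pow, one_pow, pow_succ]
      field_simp

variable {Ω : Type w} [MeasurableSpace Ω] {μ : Measure Ω} [IsProbabilityMeasure μ]
  {η : Fin V → ℕ → Fin n → Ω → ℝ}

/-- The allowed error `2^{-t}` is split evenly: the bias takes at most one half, so the noise must
exceed the other. The `8 · 4^t` in the sample size comes from `r²/(2σ²)` with `r = 2^{-t}/2`. -/
lemma measure_pair_inaccurate_le (hB : 0 < B) {θ : H} (hθ : ‖θ‖ ≤ B)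
    (hval : cfg.Valid M B) (hV : 1 ≤ V) (hn : 2 ≤ n) (hs : s.Sound M cfg)
    (hsub : ∀ v τ i, HasSubgaussianMGF (η v τ i) 1 μ)
    (hind : iIndepFun (fun (p : Fin V × ℕ) (ω : Ω) (i : Fin n) => η p.1 p.2 i ω) μ)
    {v : Fin V} {i j : Fin n} (hi : i ∈ s.alive v) (hj : j ∈ s.alive v) :
    μ.real {ω | M.reward θ (v, i) - M.reward θ (v, j) + (1 / 2 : ℝ) ^ s.phase
      ≤ gapEst M (phaseMessages M cfg (rewardTable M θ η ω) s)
        (numSamples M cfg s.phase s.alive * cfg.ξ s.phase) (v, i) (v, j)}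
      ≤ cfg.deltaAt s.phase / (2 * (n : ℝ) ^ 2 * V) := by
  have hN : (0 : ℝ) < numSamples M cfg s.phase s.alive :=
    Nat.cast_pos.2 (numSamples_pos hval hV hn hs)
  have hξ := hval.ξ_pos _ hs.one_le_phase
  have hε := hval.ε_pos
  have hρ := hs.optValue_pos
  have hbias := bias_phase_le hB hθ hval hV hn hs hi hj
  have hvar := (sum_noiseCoeff_sq_le M cfg s (mul_pos hN hξ) (v, i) (v, j)).trans
    (invNormSq_phase_le hval hV hn hs hi hj)
  have hlog := hval.one_lt_log_arg hV hn hs.one_le_phase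
  have hceil := Nat.le_ceil (8 * ((2 : ℝ) ^ s.phase) ^ 2 * (1 + cfg.ε) ^ 2
    * M.optValue (cfg.ξ s.phase) s.alive
    * Real.log (2 * (n : ℝ) ^ 2 * V / cfg.deltaAt s.phase))
  change _ ≤ (numSamples M cfg s.phase s.alive : ℝ) at hceil
  have hr : (0 : ℝ) ≤ (1 / 2 : ℝ) ^ s.phase / 2 := by positivity
  have he : Function.Injective fun p : Σ v, Fin (agentSeq (phaseSeq M cfg s) v).length =>
      ((p.1, s.clock p.1 + p.2) : Fin V × ℕ) := by
    rintro ⟨v, m⟩ ⟨v', m'⟩ h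
    obtain ⟨h1, h2⟩ := Prod.mk.inj h
    subst h1
    congr 1
    exact Fin.ext (by simpa using h2)
  have htail := measure_sum_noise_ge_le hsub hind he (fun p => (sampleArm M cfg s p).2)
    (fun p => noiseCoeff M cfg s (numSamples M cfg s.phase s.alive * cfg.ξ s.phase) (v, i) (v, j)
      (sampleArm M cfg s p)) hvar hr
  refine le_trans (measureReal_mono fun ω hω => ?_) (htail.trans ?_)
  · have h := gapEst_phase M cfg θ η ω s (mul_pos hN hξ) (v, i) (v, j)
    have hω' : M.reward θ (v, i) - M.reward θ (v, j) + (1 / 2 : ℝ) ^ s.phase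
      ≤ gapEst M (phaseMessages M cfg (rewardTable M θ η ω) s)
        (numSamples M cfg s.phase s.alive * cfg.ξ s.phase) (v, i) (v, j) := hω
    have h2 := neg_abs_le (inner ℝ (M.phi (v, i) - M.phi (v, j))
          ((M.designOp (numSamples M cfg s.phase s.alive * cfg.ξ s.phase)
            (phaseCount M cfg s)).inverse θ))
    have h3 := mul_le_mul_of_nonneg_left h2 (mul_pos hN hξ).le
    refine Set.mem_ofPred.2 ?_
    linarith
  · set N : ℝ := ((numSamples M cfg s.phase s.alive : ℕ) : ℝ)
    set ρ := M.optValue (cfg.ξ s.phase) s.alive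
    set ℓ := Real.log (2 * (n : ℝ) ^ 2 * V / cfg.deltaAt s.phase) with hℓ
    have hℓ0 : 0 < ℓ := Real.log_pos hlog
    have hexp : cfg.deltaAt s.phase / (2 * (n : ℝ) ^ 2 * V) = Real.exp (-ℓ) := by
      rw [hℓ, Real.exp_neg, Real.exp_log (one_pos.trans hlog), inv_div]
    rw [hexp, Real.exp_le_exp, neg_div, neg_le_neg_iff, le_div_iff₀ (by positivity)]
    have h2 : ((1 / 2 : ℝ) ^ s.phase / 2) ^ 2 = 1 / (4 * ((2 : ℝ) ^ s.phase) ^ 2) := by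
      rw [div_pow 1 2, one_pow]
      field_simp
      norm_num
    rw [h2, le_div_iff₀ (by positivity)]
    have h3 : ℓ * (2 * ((1 + cfg.ε) * ρ / N)) * (4 * ((2 : ℝ) ^ s.phase) ^ 2)
        = (8 * ((2 : ℝ) ^ s.phase) ^ 2 * (1 + cfg.ε) * ρ * ℓ) / N := by ring
    rw [h3, div_le_one hN]
    refine le_trans ?_ hceil
    have h4 : 0 ≤ 8 * ((2 : ℝ) ^ s.phase) ^ 2 * (1 + cfg.ε) * ρ * ℓ := by positivity
    calc 8 * ((2 : ℝ) ^ s.phase) ^ 2 * (1 + cfg.ε) * ρ * ℓ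
        ≤ (1 + cfg.ε) * (8 * ((2 : ℝ) ^ s.phase) ^ 2 * (1 + cfg.ε) * ρ * ℓ) := by nlinarith
      _ = _ := by ring

/-- Union bound over the `n² V` ordered pairs, each costing `δ_t / (2 n² V)`. -/
lemma measure_inaccurate_le (hB : 0 < B) {θ : H} (hθ : ‖θ‖ ≤ B)
    (hval : cfg.Valid M B) (hV : 1 ≤ V) (hn : 2 ≤ n) (hs : s.Sound M cfg)
    (hsub : ∀ v τ i, HasSubgaussianMGF (η v τ i) 1 μ)
    (hind : iIndepFun (fun (p : Fin V × ℕ) (ω : Ω) (i : Fin n) => η p.1 p.2 i ω) μ) :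
    μ.real {ω | Inaccurate M cfg θ s (rewardTable M θ η ω)} ≤ cfg.deltaAt s.phase / 2 := by
  have hV' : (0 : ℝ) < V := by exact_mod_cast hV
  have hn' : (0 : ℝ) < n := by exact_mod_cast one_pos.trans hn
  have hδ : 0 ≤ cfg.deltaAt s.phase := div_nonneg hval.δ_pos.le (by positivity)
  have hsubset : {ω | Inaccurate M cfg θ s (rewardTable M θ η ω)}
      ⊆ ⋃ q : Fin V × Fin n × Fin n, {ω | (q.2.1 ∈ s.alive q.1 ∧ q.2.2 ∈ s.alive q.1) ∧
        M.reward θ (q.1, q.2.1) - M.reward θ (q.1, q.2.2) + (1 / 2 : ℝ) ^ s.phase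
        ≤ gapEst M (phaseMessages M cfg (rewardTable M θ η ω) s)
          (numSamples M cfg s.phase s.alive * cfg.ξ s.phase) (q.1, q.2.1) (q.1, q.2.2)} := by
    rintro ω ⟨v, i, hi, j, hj, h⟩
    exact Set.mem_iUnion.2 ⟨(v, i, j), ⟨hi, hj⟩, h⟩
  refine (measureReal_mono hsubset).trans ((measureReal_iUnion_fintype_le _).trans ?_)
  calc _ ≤ ∑ _q : Fin V × Fin n × Fin n, cfg.deltaAt s.phase / (2 * (n : ℝ) ^ 2 * V) := by
        refine Finset.sum_le_sum fun q _ => ?_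
        by_cases hq : q.2.1 ∈ s.alive q.1 ∧ q.2.2 ∈ s.alive q.1
        · refine le_trans (measureReal_mono fun ω hω => ?_)
            (measure_pair_inaccurate_le hB hθ hval hV hn hs hsub hind hq.1 hq.2)
          exact hω.2
        · have : {ω | (q.2.1 ∈ s.alive q.1 ∧ q.2.2 ∈ s.alive q.1) ∧
              M.reward θ (q.1, q.2.1) - M.reward θ (q.1, q.2.2) + (1 / 2 : ℝ) ^ s.phase
              ≤ gapEst M (phaseMessages M cfg (rewardTable M θ η ω) s)
                (numSamples M cfg s.phase s.alive * cfg.ξ s.phase) (q.1, q.2.1) (q.1, q.2.2)}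
              = ∅ := Set.eq_empty_of_forall_notMem fun ω hω => hq hω.1
          rw [this, measureReal_empty]
          positivity
    _ = cfg.deltaAt s.phase / 2 := by
        simp only [Finset.sum_const, Finset.card_univ, Fintype.card_prod, Fintype.card_fin,
          nsmul_eq_mul, Nat.cast_mul]
        field_simp

end PhaseFailure

end CoopKernel

end

namespace CoopKernel

variable {d V n : ℕ} {Z : Type u} {H : Type v} [NormedAddCommGroup H] [InnerProductSpace ℝ H]

/-! ### Gaps and the number of phases -/

section Gaps

variable {M : Model d V n Z H} {θ : H} {best : Fin V → Fin n} {B κ : ℝ}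

lemma gap_eq_inner (a : Arm V n) :
    gap M θ best a = inner ℝ (M.phi (a.1, best a.1) - M.phi a) θ := by
  rw [gap, M.reward_eq_inner, M.reward_eq_inner, inner_sub_left]

lemma gap_best (v : Fin V) : gap M θ best (v, best v) = 0 := sub_self _

lemma gap_le_norm_mul (hθ : ‖θ‖ ≤ B) (a : Arm V n) :
    gap M θ best a ≤ ‖M.phi (a.1, best a.1) - M.phi a‖ * B := by
  rw [gap_eq_inner]
  exact (real_inner_le_norm _ _).trans (by gcongr)

lemma norm_phi_le (hκ : ∀ a, M.kernel a a ≤ κ) (a : Arm V n) : ‖M.phi a‖ ≤ √κ := by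
  refine Real.le_sqrt_of_sq_le ?_
  rw [← real_inner_self_eq_norm_sq, M.inner_phi]
  exact hκ a

lemma nonneg_of_kernel_le (hκ : ∀ a, M.kernel a a ≤ κ) (a : Arm V n) : 0 ≤ κ := by
  refine le_trans ?_ (hκ a)
  rw [← M.inner_phi]
  exact real_inner_self_nonneg

lemma gap_le (hκ : ∀ a, M.kernel a a ≤ κ) (hθ : ‖θ‖ ≤ B) (a : Arm V n) :
    gap M θ best a ≤ 2 * (√κ * B) := by
  have hB : 0 ≤ B := (norm_nonneg θ).trans hθ
  refine (gap_le_norm_mul hθ a).trans ?_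
  have h := (norm_sub_le (M.phi (a.1, best a.1)) (M.phi a)).trans
    (add_le_add (norm_phi_le hκ _) (norm_phi_le hκ _))
  calc _ ≤ (√κ + √κ) * B := by gcongr
    _ = _ := by ring

lemma gap_pos (hbest : ∀ v i, i ≠ best v → M.reward θ (v, i) < M.reward θ (v, best v))
    {a : Arm V n} (ha : a.2 ≠ best a.1) : 0 < gap M θ best a :=
  sub_pos.2 (hbest _ _ ha)

lemma gap_nonneg (hbest : ∀ v i, i ≠ best v → M.reward θ (v, i) < M.reward θ (v, best v))
    (a : Arm V n) : 0 ≤ gap M θ best a := by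
  by_cases ha : a.2 = best a.1
  · have : a = (a.1, best a.1) := Prod.ext rfl ha
    rw [this, gap_best]
  · exact (gap_pos hbest ha).le

lemma nonempty_suboptimal (best : Fin V → Fin n) (hV : 1 ≤ V) (hn : 2 ≤ n) :
    Nonempty {a : Arm V n // a.2 ≠ best a.1} := by
  have := Fin.nontrivial_iff_two_le.2 hn
  obtain ⟨i, hi⟩ := exists_ne (best ⟨0, hV⟩)
  exact ⟨⟨(⟨0, hV⟩, i), hi⟩⟩

lemma minGap_le {a : Arm V n} (ha : a.2 ≠ best a.1) : minGap M θ best ≤ gap M θ best a :=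
  ciInf_le (f := fun a : {a : Arm V n // a.2 ≠ best a.1} => gap M θ best a.1)
    (Set.finite_range _).bddBelow ⟨a, ha⟩

lemma minGap_pos (hV : 1 ≤ V) (hn : 2 ≤ n)
    (hbest : ∀ v i, i ≠ best v → M.reward θ (v, i) < M.reward θ (v, best v)) :
    0 < minGap M θ best := by
  have := nonempty_suboptimal best hV hn
  obtain ⟨a, ha⟩ := exists_eq_ciInf_of_finite
    (f := fun a : {a : Arm V n // a.2 ≠ best a.1} => gap M θ best a.1)
  rw [minGap, ← ha]
  exact gap_pos hbest a.2

end Gaps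

section LastPhase

/-- The ceiling gives `2^{T-1} Δ ≥ 1`; the extra phase supplies the factor `2` that matches the
surviving gaps `< 2 · 2^{-T}`. -/
lemma two_le_two_pow_lastPhase_mul {Δ : ℝ} (hΔ : 0 < Δ) : 2 ≤ 2 ^ lastPhase Δ * Δ := by
  have h1 : Δ⁻¹ ≤ 2 ^ ⌈Real.logb 2 Δ⁻¹⌉₊ := by
    rw [← Real.rpow_natCast, ← Real.logb_le_iff_le_rpow one_lt_two (inv_pos.2 hΔ)]
    exact Nat.le_ceil _
  rw [lastPhase, pow_succ]
  have h2 : 1 ≤ 2 ^ ⌈Real.logb 2 Δ⁻¹⌉₊ * Δ := by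
    rwa [← inv_le_iff_one_le_mul₀ hΔ]
  linarith

lemma one_le_logInv (Δ : ℝ) : 1 ≤ logInv Δ := le_max_left _ _

lemma lastPhase_le (Δ : ℝ) : (lastPhase Δ : ℝ) ≤ 4 * logInv Δ := by
  have hL := one_le_logInv Δ
  rw [lastPhase]
  push_cast
  by_cases h : 0 ≤ Real.logb 2 Δ⁻¹
  · have h1 := Nat.ceil_lt_add_one h
    -- Since `log 2 > 1/2`, the base-two logarithm is at most `2 L`; the ceiling and the final `+1`
    -- add at most `2 ≤ 2 L`.
    have h2 : Real.logb 2 Δ⁻¹ ≤ 2 * logInv Δ := by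
      rw [Real.logb, div_le_iff₀ (Real.log_pos one_lt_two)]
      have h3 : Real.log Δ⁻¹ ≤ logInv Δ := le_max_right _ _
      have h4 := Real.log_two_gt_d9
      nlinarith
    linarith
  · rw [Nat.ceil_eq_zero.2 (not_le.1 h).le]
    norm_num
    linarith

lemma minReg_le {ξ : ℕ → ℝ} {T t : ℕ} (ht : 1 ≤ t) (htT : t ≤ T) : minReg ξ T ≤ ξ t :=
  ciInf_le (f := fun t : Set.Icc 1 T => ξ t) (Set.finite_range _).bddBelow ⟨t, ht, htT⟩

lemma minReg_pos {ξ : ℕ → ℝ} {T : ℕ} (hT : 1 ≤ T) (hξ : ∀ t, 1 ≤ t → 0 < ξ t) :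
    0 < minReg ξ T := by
  have : Nonempty (Set.Icc 1 T) := ⟨⟨1, le_rfl, hT⟩⟩
  obtain ⟨t, ht⟩ := exists_eq_ciInf_of_finite (f := fun t : Set.Icc 1 T => ξ t)
  rw [minReg, ← ht]
  exact hξ t t.2.1

end LastPhase

/-! ### Elimination and termination when the phases are accurate -/

section Elimination

variable {M : Model d V n Z H} {cfg : Config V n} {θ : H} {best : Fin V → Fin n}
  {y : Fin V → ℕ → Fin n → ℝ} {s : State V n}

lemma mem_step_alive (y : Fin V → ℕ → Fin n → ℝ) (s : State V n) (v : Fin V) (i : Fin n) :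
    i ∈ (step M cfg y s).alive v ↔ i ∈ s.alive v ∧ ∀ j ∈ s.alive v,
      gapEst M (phaseMessages M cfg y s)
        (numSamples M cfg s.phase s.alive * cfg.ξ s.phase) (v, j) (v, i)
          < (1 / 2 : ℝ) ^ s.phase := by
  change i ∈ eliminate M cfg (phaseMessages M cfg y s) s v ↔ _
  unfold eliminate
  simp only [Finset.mem_sdiff, Finset.mem_filter, not_and, not_exists, not_le]
  tauto

lemma best_mem_step_alive (h : ¬ Inaccurate M cfg θ s y)
    (hbest : ∀ v i, i ≠ best v → M.reward θ (v, i) < M.reward θ (v, best v))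
    (hs : ∀ v, best v ∈ s.alive v) (v : Fin V) : best v ∈ (step M cfg y s).alive v := by
  refine (mem_step_alive y s v _).2 ⟨hs v, fun j hj => ?_⟩
  by_contra! hge
  refine h ⟨v, j, hj, best v, hs v, le_trans ?_ hge⟩
  have := gap_nonneg hbest (v, j)
  rw [gap] at this
  linarith

/-- A survivor is estimated less than `2^{-t}` below the best arm, and accuracy for the reversed
pair costs another `2^{-t}`. -/
lemma gap_mul_lt_of_mem_step (h : ¬ Inaccurate M cfg θ s y) (hs : ∀ v, best v ∈ s.alive v)
    {v : Fin V} {i : Fin n} (hi : i ∈ (step M cfg y s).alive v) :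
    gap M θ best (v, i) * 2 ^ s.phase < 2 := by
  obtain ⟨hi, hest⟩ := (mem_step_alive y s v i).1 hi
  have h1 := hest _ (hs v)
  have h2 : gapEst M (phaseMessages M cfg y s)
      (numSamples M cfg s.phase s.alive * cfg.ξ s.phase) (v, i) (v, best v)
      < M.reward θ (v, i) - M.reward θ (v, best v) + (1 / 2 : ℝ) ^ s.phase := by
    by_contra! hge
    exact h ⟨v, i, hi, best v, hs v, hge⟩
  rw [gapEst_swap] at h2
  have h3 : gap M θ best (v, i) < 2 * (1 / 2 : ℝ) ^ s.phase := by
    rw [gap]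
    linarith
  calc gap M θ best (v, i) * 2 ^ s.phase < 2 * (1 / 2 : ℝ) ^ s.phase * 2 ^ s.phase := by gcongr
    _ = 2 := by rw [mul_assoc, ← mul_pow]; norm_num

end Elimination

section Execution

variable {M : Model d V n Z H} {cfg : Config V n} {θ : H} {best : Fin V → Fin n}
  {y : Fin V → ℕ → Fin n → ℝ} {B κ : ℝ}

lemma sum_clock_run_le (hround : RoundsWell M cfg y) {X : ℝ} {k : ℕ}
    (hrun : ∀ j < k, (run M cfg y j).Running)
    (hX : ∀ j < k, (numSamples M cfg (run M cfg y j).phase (run M cfg y j).alive : ℝ) ≤ X) :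
    ∑ v, ((run M cfg y k).clock v : ℝ) ≤ k * X := by
  induction k with
  | zero => simp [run_zero, State.init]
  | succ k ih =>
    have h1 := ih (fun j hj => hrun j (hj.trans k.lt_succ_self))
      (fun j hj => hX j (hj.trans k.lt_succ_self))
    have h2 := hX k k.lt_succ_self
    have h3 : (phaseSeq M cfg (run M cfg y k)).length
        = numSamples M cfg (run M cfg y k).phase (run M cfg y k).alive :=
      (hround k fun j hj => hrun j (Nat.lt_succ_of_le hj)).1
    rw [run_succ]
    simp only [step_clock, Nat.cast_add, Finset.sum_add_distrib]
    rw [← Nat.cast_sum, ← Nat.cast_sum, sum_length_agentSeq, h3, Nat.cast_sum]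
    push_cast
    linarith

variable [CompleteSpace H]

lemma optValue_pos {c : ℝ} (hc : 0 < c) (hV : 1 ≤ V) (hn : 1 ≤ n) (hκ : ∀ a, M.kernel a a ≤ κ)
    {S : Alive V n} {v : Fin V} {i j : Fin n} (hi : i ∈ S v) (hj : j ∈ S v)
    (hij : M.phi (v, i) ≠ M.phi (v, j)) : 0 < M.optValue c S := by
  have hκ0 := nonneg_of_kernel_le hκ (v, i)
  have hpos : 0 < ‖M.phi (v, i) - M.phi (v, j)‖ := norm_pos_iff.2 (sub_ne_zero.2 hij)
  have : Nonempty (stdSimplex ℝ (Arm V n)) := ⟨⟨_, uniform_mem_stdSimplex hV hn⟩⟩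
  have h : ‖M.phi (v, i) - M.phi (v, j)‖ ^ 2 / (c + κ) ≤ M.optValue c S := le_ciInf fun w =>
    (Model.norm_sq_div_le_invNormSq hc w.2 hκ hκ0 _).trans
      (Model.invNormSq_le_designValue S hi hj)
  exact lt_of_lt_of_le (by positivity) h

/-- The alive sets contain the best arms, and the gaps of the alive arms are small. -/
structure State.Shrunk (M : Model d V n Z H) (θ : H) (best : Fin V → Fin n) (G : ℝ)
    (s : State V n) : Prop where
  best_mem : ∀ v, best v ∈ s.alive v
  gap_le : ∀ v, ∀ i ∈ s.alive v, gap M θ best (v, i) * 2 ^ s.phase ≤ 4 * G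

/-- A second alive arm beside the best one has a different reward, hence a different feature vector,
so the design optimum is positive. -/
lemma sound_of_running (hval : cfg.Valid M B) (hV : 1 ≤ V) (hn : 2 ≤ n)
    (hκ : ∀ a, M.kernel a a ≤ κ)
    (hbest : ∀ v i, i ≠ best v → M.reward θ (v, i) < M.reward θ (v, best v))
    {s : State V n} (hphase : 1 ≤ s.phase) (hmem : ∀ v, best v ∈ s.alive v) (hrun : s.Running)
    (hround : M.IsRounding cfg.ε (cfg.ξ s.phase) s.alive (phaseAlloc cfg s)
      (numSamples M cfg s.phase s.alive) (phaseSeq M cfg s)) : s.Sound M cfg := by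
  refine ⟨hphase, ?_, hround⟩
  obtain ⟨v, hv⟩ := hrun
  obtain ⟨i, hi, hne⟩ := Finset.exists_mem_ne hv (best v)
  refine optValue_pos (hval.ξ_pos _ hphase) hV (one_le_two.trans hn) hκ hi (hmem v) fun h => ?_
  have := hbest v i hne
  rw [M.reward_eq_inner, M.reward_eq_inner, h] at this
  exact lt_irrefl _ this

/-- Accuracy is available only for sound states, and soundness needs the best arms alive, so both
advance in one induction. The constant `4 G` unites the a priori bound `2 √κ B` at phase one with
`gap · 2^k < 2` at phase `k + 1`. -/
lemma shrunk_run (hval : cfg.Valid M B) (hV : 1 ≤ V) (hn : 2 ≤ n) (hκ : ∀ a, M.kernel a a ≤ κ)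
    (hθ : ‖θ‖ ≤ B)
    (hbest : ∀ v i, i ≠ best v → M.reward θ (v, i) < M.reward θ (v, best v))
    (hround : RoundsWell M cfg y) {T : ℕ}
    (hacc : ∀ k < T, (run M cfg y k).Sound M cfg → ¬ Inaccurate M cfg θ (run M cfg y k) y)
    {k : ℕ} (hk : k ≤ T) (hrun : ∀ j < k, (run M cfg y j).Running) :
    (run M cfg y k).Shrunk M θ best (max 1 (√κ * B)) ∧
      (k ≠ 0 → ∀ v, ∀ i ∈ (run M cfg y k).alive v, gap M θ best (v, i) * 2 ^ k < 2) := by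
  induction k with
  | zero =>
    refine ⟨⟨fun v => Finset.mem_univ _, fun v i _ => ?_⟩, fun h => absurd rfl h⟩
    rw [run_phase, zero_add, pow_one]
    have h1 := gap_le (best := best) hκ hθ (v, i)
    have h2 := le_max_right 1 (√κ * B)
    linarith
  | succ k ih =>
    obtain ⟨hsh, -⟩ := ih (Nat.le_of_succ_le hk) fun j hj => hrun j (hj.trans k.lt_succ_self)
    have hR := hround k fun j hj => hrun j (Nat.lt_succ_of_le hj)
    have hs := sound_of_running hval hV hn hκ hbest
      (by rw [run_phase]; exact Nat.le_add_left _ _) hsh.best_mem (hrun k k.lt_succ_self) hR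
    have hA := hacc k hk hs
    have hlt : ∀ v, ∀ i ∈ (run M cfg y (k + 1)).alive v,
        gap M θ best (v, i) * 2 ^ (k + 1) < 2 := fun v i hi => by
      rw [run_succ] at hi
      have := gap_mul_lt_of_mem_step hA hsh.best_mem hi
      rwa [run_phase] at this
    refine ⟨⟨fun v => ?_, fun v i hi => ?_⟩, fun _ => hlt⟩
    · rw [run_succ]
      exact best_mem_step_alive hA hbest hsh.best_mem v
    · have h1 := hlt v i hi
      rw [run_phase, pow_succ]
      have h2 := le_max_left 1 (√κ * B)
      linarith

/-- If all phases up to the last one are accurate, the algorithm terminates by then, with the best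
arms. -/
lemma exists_terminates (hval : cfg.Valid M B) (hV : 1 ≤ V) (hn : 2 ≤ n)
    (hκ : ∀ a, M.kernel a a ≤ κ) (hθ : ‖θ‖ ≤ B)
    (hbest : ∀ v i, i ≠ best v → M.reward θ (v, i) < M.reward θ (v, best v))
    (hround : RoundsWell M cfg y)
    (hacc : ∀ k < lastPhase (minGap M θ best), (run M cfg y k).Sound M cfg →
      ¬ Inaccurate M cfg θ (run M cfg y k) y) :
    ∃ k ≤ lastPhase (minGap M θ best), (∀ j < k, (run M cfg y j).Running) ∧
      ¬ (run M cfg y k).Running ∧ ∀ v, (run M cfg y k).alive v = {best v} := by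
  classical
  have hex : ∃ k ≤ lastPhase (minGap M θ best), ¬ (run M cfg y k).Running := by
    by_contra! hall
    obtain ⟨hsh, hlt⟩ := shrunk_run hval hV hn hκ hθ hbest hround hacc le_rfl
      fun j hj => hall j hj.le
    obtain ⟨v, hv⟩ := hall _ le_rfl
    obtain ⟨i, hi, hne⟩ := Finset.exists_mem_ne hv (best v)
    have h1 := hlt (by simp [lastPhase]) v i hi
    have h2 := two_le_two_pow_lastPhase_mul (minGap_pos hV hn hbest)
    have h3 : minGap M θ best ≤ gap M θ best (v, i) := minGap_le (a := (v, i)) hne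
    have h4 := mul_le_mul_of_nonneg_left h3
      (pow_nonneg (zero_le_two (α := ℝ)) (lastPhase (minGap M θ best)))
    linarith
  have hex' : ∃ k, ¬ (run M cfg y k).Running := hex.imp fun _ h => h.2
  have hle : Nat.find hex' ≤ lastPhase (minGap M θ best) := by
    obtain ⟨k, hk, hk'⟩ := hex
    exact (Nat.find_min' hex' hk').trans hk
  have hbefore : ∀ j < Nat.find hex', (run M cfg y j).Running := fun j hj =>
    not_not.1 (Nat.find_min hex' hj)
  refine ⟨Nat.find hex', hle, hbefore, Nat.find_spec hex', fun v => ?_⟩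
  have hsh := (shrunk_run hval hV hn hκ hθ hbest hround hacc hle hbefore).1
  have hcard : ((run M cfg y (Nat.find hex')).alive v).card ≤ 1 := by
    by_contra! h
    exact Nat.find_spec hex' ⟨v, h⟩
  exact (Finset.eq_of_subset_of_card_le (Finset.singleton_subset_iff.2 (hsh.best_mem v))
    (by simpa using hcard)).symm

end Execution

/-! ### Sample size against the hardness -/

section SampleBound

variable {M : Model d V n Z H} {cfg : Config V n} {θ : H} {best : Fin V → Fin n} {B κ : ℝ}

lemma invNormSq_le_gap_sq_mul
    (hbest : ∀ v i, i ≠ best v → M.reward θ (v, i) < M.reward θ (v, best v)) (ξ : ℝ)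
    (w : Arm V n → ℝ) (a : Arm V n) :
    M.invNormSq ξ w (M.phi (a.1, best a.1) - M.phi a) ≤ gap M θ best a ^ 2 *
      ⨆ a : {a : Arm V n // a.2 ≠ best a.1},
        M.invNormSq ξ w (M.phi (a.1.1, best a.1.1) - M.phi a.1) / gap M θ best a.1 ^ 2 := by
  by_cases ha : a.2 = best a.1
  · obtain ⟨v, i⟩ := a
    obtain rfl : i = best v := ha
    simp [Model.invNormSq, gap_best]
  · have hg := gap_pos hbest ha
    rw [← div_le_iff₀' (by positivity)]
    exact le_ciSup (f := fun a : {a : Arm V n // a.2 ≠ best a.1} =>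
      M.invNormSq ξ w (M.phi (a.1.1, best a.1.1) - M.phi a.1) / gap M θ best a.1 ^ 2)
      (Set.finite_range _).bddAbove ⟨a, ha⟩

lemma log_sampleSize_le (hval : cfg.Valid M B) (hV : 1 ≤ V) (hn : 2 ≤ n) {t : ℕ} (ht : 1 ≤ t)
    {L : ℝ} (hL : 1 ≤ L) (htL : (t : ℝ) ≤ 4 * L) :
    Real.log (2 * (n : ℝ) ^ 2 * V / cfg.deltaAt t)
      ≤ 8 * (Real.log (n * V / cfg.δ) + Real.log L) := by
  have hδ := hval.δ_pos
  have hδ1 := hval.δ_lt_one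
  have hV' : (1 : ℝ) ≤ V := by exact_mod_cast hV
  have hn' : (2 : ℝ) ≤ n := by exact_mod_cast hn
  have ht' : (1 : ℝ) ≤ t := by exact_mod_cast ht
  have hx2 : 2 ≤ n * V / cfg.δ := by
    rw [le_div_iff₀ hδ]
    nlinarith
  have hV0 : (0 : ℝ) < V := by linarith
  have hn0 : (0 : ℝ) < n := by linarith
  have hx1 : (n : ℝ) ^ 2 * V / cfg.δ ≤ (n * V / cfg.δ) ^ 2 := by
    rw [div_pow, div_le_div_iff₀ hδ (by positivity)]
    have h1 : cfg.δ * cfg.δ ≤ V * cfg.δ := by nlinarith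
    calc (n : ℝ) ^ 2 * V * cfg.δ ^ 2 = (n : ℝ) ^ 2 * V * (cfg.δ * cfg.δ) := by ring
      _ ≤ (n : ℝ) ^ 2 * V * (V * cfg.δ) := by gcongr
      _ = _ := by ring
  set x := n * V / cfg.δ with hx
  have harg : 2 * (n : ℝ) ^ 2 * V / cfg.deltaAt t ≤ x ^ 8 * L ^ 8 := by
    calc 2 * (n : ℝ) ^ 2 * V / cfg.deltaAt t = 4 * ((n : ℝ) ^ 2 * V / cfg.δ) * (t : ℝ) ^ 2 := by
          rw [Config.deltaAt]
          field_simp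
          norm_num
      -- The constant `4 · 4² = 2^6` is absorbed into `x^6` because `x ≥ 2`.
      _ ≤ 4 * x ^ 2 * (4 * L) ^ 2 := by gcongr
      _ = 2 ^ 6 * x ^ 2 * L ^ 2 := by ring
      _ ≤ x ^ 6 * x ^ 2 * L ^ 8 := by
        gcongr ?_ * x ^ 2 * ?_
        · gcongr
        · exact pow_le_pow_right₀ hL (by norm_num)
      _ = _ := by ring
  have hx0 : 0 < x := by linarith
  calc Real.log (2 * (n : ℝ) ^ 2 * V / cfg.deltaAt t) ≤ Real.log (x ^ 8 * L ^ 8) :=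
        Real.log_le_log (one_pos.trans (hval.one_lt_log_arg hV hn ht)) harg
    _ = 8 * (Real.log x + Real.log L) := by
        rw [Real.log_mul (by positivity) (by positivity), Real.log_pow, Real.log_pow]
        push_cast
        ring

lemma half_le_log_add_log (hval : cfg.Valid M B) (hV : 1 ≤ V) (hn : 2 ≤ n) {L : ℝ} (hL : 1 ≤ L) :
    1 / 2 ≤ Real.log (n * V / cfg.δ) + Real.log L := by
  have hδ := hval.δ_pos
  have hδ1 := hval.δ_lt_one
  have hV' : (1 : ℝ) ≤ V := by exact_mod_cast hV
  have hn' : (2 : ℝ) ≤ n := by exact_mod_cast hn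
  have hx2 : 2 ≤ n * V / cfg.δ := by
    rw [le_div_iff₀ hδ]
    nlinarith
  have h1 := Real.log_le_log two_pos hx2
  have h2 := Real.log_nonneg hL
  have h3 := Real.log_two_gt_d9
  linarith

variable [CompleteSpace H]

/-- For each allocation, a difference of alive arms passes through the best arm, each leg is at most
`(4G/2^t)²` times the hardness ratio, and the two legs give `4 · 16 = 64`. Lowering the
regularization to `ξ'` only enlarges the norms. -/
lemma optValue_mul_le_hardness (hV : 1 ≤ V) (hn : 1 ≤ n)
    (hbest : ∀ v i, i ≠ best v → M.reward θ (v, i) < M.reward θ (v, best v)) {ξ ξ' G : ℝ}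
    (hξ' : 0 < ξ') (hξ : ξ' ≤ ξ) (hG : 0 < G) {s : State V n} (hs : s.Shrunk M θ best G) :
    ((2 : ℝ) ^ s.phase) ^ 2 * M.optValue ξ s.alive ≤ 64 * G ^ 2 * hardness M θ best ξ' := by
  have hne : Nonempty (stdSimplex ℝ (Arm V n)) := ⟨⟨_, uniform_mem_stdSimplex hV hn⟩⟩
  rw [← div_le_iff₀' (by positivity)]
  refine le_ciInf fun w => ?_
  rw [div_le_iff₀' (by positivity), ← le_div_iff₀' (by positivity)]
  set R := ⨆ a : {a : Arm V n // a.2 ≠ best a.1},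
    M.invNormSq ξ' w (M.phi (a.1.1, best a.1.1) - M.phi a.1) / gap M θ best a.1 ^ 2 with hR
  have hR0 : 0 ≤ R := Real.iSup_nonneg fun a =>
    div_nonneg (Model.invNormSq_nonneg hξ' w.2.1 _) (sq_nonneg _)
  have hterm : ∀ v, ∀ i ∈ s.alive v, M.invNormSq ξ' w (M.phi (v, best v) - M.phi (v, i))
      ≤ (4 * G / 2 ^ s.phase) ^ 2 * R := fun v i hi => by
    refine (invNormSq_le_gap_sq_mul hbest ξ' w (v, i)).trans ?_
    have h1 : gap M θ best (v, i) ≤ 4 * G / 2 ^ s.phase := by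
      rw [le_div_iff₀ (by positivity)]
      exact hs.gap_le v i hi
    have h0 := gap_nonneg hbest (v, i)
    gcongr
  refine (Model.optValue_le (hξ'.trans_le hξ) s.alive w.2).trans
    (Model.designValue_le (by positivity) fun v i hi j hj => ?_)
  refine (Model.invNormSq_anti hξ' hξ w.2.1 _).trans ?_
  have hsplit : M.phi (v, i) - M.phi (v, j)
      = (M.phi (v, best v) - M.phi (v, j)) - (M.phi (v, best v) - M.phi (v, i)) := by abel
  rw [hsplit]
  refine (Model.invNormSq_sub_le hξ' w.2.1 _ _).trans ?_
  have h1 := hterm v i hi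
  have h2 := hterm v j hj
  calc _ ≤ 2 * ((4 * G / 2 ^ s.phase) ^ 2 * R) + 2 * ((4 * G / 2 ^ s.phase) ^ 2 * R) := by
        gcongr
        exacts [h2, h1]
    _ = 64 * G ^ 2 * R / ((2 : ℝ) ^ s.phase) ^ 2 := by ring

/-- The regularization parameter of the last phase is at most the kernel bound. -/
lemma xi_lastPhase_le (hB : 0 < B) (hval : cfg.Valid M B) (hV : 1 ≤ V) (hn : 2 ≤ n)
    (hκ : ∀ a, M.kernel a a ≤ κ) (hθ : ‖θ‖ ≤ B)
    (hbest : ∀ v i, i ≠ best v → M.reward θ (v, i) < M.reward θ (v, best v)) :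
    cfg.ξ (lastPhase (minGap M θ best)) ≤ κ := by
  set T := lastPhase (minGap M θ best) with hT
  have hT1 : 1 ≤ T := Nat.le_add_left _ _
  have hξ := hval.ξ_pos T hT1
  have hε := hval.ε_pos
  obtain ⟨⟨v, i⟩, hi⟩ := nonempty_suboptimal best hV hn
  have hκ0 := nonneg_of_kernel_le hκ (v, i)
  have hΔ := minGap_pos hV hn hbest
  have h1 := (hval.ξ_cond T hT1).mul_invNormSq_le hξ v (best v) i
  have h2 := Model.norm_sq_div_le_invNormSq (M := M) hξ
    (uniform_mem_stdSimplex hV (one_le_two.trans hn)) hκ hκ0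
    (M.phi (v, best v) - M.phi (v, i))
  have h3 := two_le_two_pow_lastPhase_mul hΔ
  rw [← hT] at h3
  have h4 : minGap M θ best ≤ ‖M.phi (v, best v) - M.phi (v, i)‖ * B :=
    (minGap_le (a := (v, i)) hi).trans (gap_le_norm_mul hθ (v, i))
  set D := ‖M.phi (v, best v) - M.phi (v, i)‖ with hD
  have h5 : 2 ≤ (1 + cfg.ε) * B * 2 ^ (T + 1) * D := by
    have h6 : 2 ^ T * minGap M θ best ≤ 2 ^ T * (D * B) := by gcongr
    have h7 : 0 ≤ 2 ^ T * (D * B) := by positivity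
    calc (2 : ℝ) ≤ 2 ^ T * (D * B) := h3.trans h6
      _ ≤ (2 * (1 + cfg.ε)) * (2 ^ T * (D * B)) := by nlinarith
      _ = _ := by ring
  have h8 : cfg.ξ T * (D ^ 2 / (cfg.ξ T + κ)) ≤ (1 / ((1 + cfg.ε) * B * 2 ^ (T + 1))) ^ 2 :=
    (mul_le_mul_of_nonneg_left h2 hξ.le).trans h1
  set E := (1 + cfg.ε) * B * 2 ^ (T + 1) with hE
  have hE0 : 0 < E := by positivity
  rw [div_pow, one_pow, le_div_iff₀ (by positivity)] at h8
  have h9 : cfg.ξ T * (E * D) ^ 2 ≤ cfg.ξ T + κ := by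
    have : cfg.ξ T * (D ^ 2 / (cfg.ξ T + κ)) * E ^ 2
        = cfg.ξ T * (E * D) ^ 2 / (cfg.ξ T + κ) := by ring
    rwa [this, div_le_one (by positivity)] at h8
  -- With `E D ≥ 2`, the bound `h9` reads `4 ξ ≤ ξ + κ`.
  have h10 : (2 : ℝ) ^ 2 ≤ (E * D) ^ 2 := by gcongr
  nlinarith

/-- By Cauchy–Schwarz a gap is at most `D B`, while the design norm is at least `D² / (ξ_* + κ)`,
and `ξ_* ≤ κ`. Hence every ratio is at least `1 / (2 κ B²)`. -/
lemma one_le_mul_rhoStar (hB : 0 < B) (hval : cfg.Valid M B) (hV : 1 ≤ V) (hn : 2 ≤ n)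
    (hκ : ∀ a, M.kernel a a ≤ κ) (hθ : ‖θ‖ ≤ B)
    (hbest : ∀ v i, i ≠ best v → M.reward θ (v, i) < M.reward θ (v, best v)) :
    1 ≤ 2 * κ * B ^ 2 * rhoStar M θ best cfg.ξ := by
  have hT1 : 1 ≤ lastPhase (minGap M θ best) := Nat.le_add_left _ _
  have hξpos := minReg_pos hT1 hval.ξ_pos
  have hξle := (minReg_le (ξ := cfg.ξ) hT1 le_rfl).trans
    (xi_lastPhase_le hB hval hV hn hκ hθ hbest)
  have hκpos : 0 < κ := hξpos.trans_le hξle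
  have hne : Nonempty (stdSimplex ℝ (Arm V n)) :=
    ⟨⟨_, uniform_mem_stdSimplex hV (one_le_two.trans hn)⟩⟩
  obtain ⟨a, ha⟩ := nonempty_suboptimal best hV hn
  rw [← div_le_iff₀' (by positivity)]
  refine le_ciInf fun w => ?_
  refine le_trans ?_ (le_ciSup (f := fun a : {a : Arm V n // a.2 ≠ best a.1} =>
    M.invNormSq (minReg cfg.ξ (lastPhase (minGap M θ best))) w
      (M.phi (a.1.1, best a.1.1) - M.phi a.1) / gap M θ best a.1 ^ 2)
    (Set.finite_range _).bddAbove ⟨a, ha⟩)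
  have hg := gap_pos hbest ha
  have hgle := gap_le_norm_mul (best := best) (M := M) hθ a
  rw [le_div_iff₀ (by positivity)]
  refine le_trans ?_ (Model.norm_sq_div_le_invNormSq hξpos w.2 hκ hκpos.le _)
  set D := ‖M.phi (a.1, best a.1) - M.phi a‖
  calc 1 / (2 * κ * B ^ 2) * gap M θ best a ^ 2 ≤ 1 / (2 * κ * B ^ 2) * (D * B) ^ 2 := by gcongr
    _ = D ^ 2 / (κ + κ) := by field_simp; ring
    _ ≤ _ := by gcongr

/-- `4096 = 8 · 64 · 8` collects the factors from the sample size, the hardness comparison and the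
logarithm; `4 |κ| B²` pays for the `+1` of the ceiling. -/
lemma numSamples_le (hB : 0 < B) (hval : cfg.Valid M B) (hV : 1 ≤ V) (hn : 2 ≤ n)
    (hκ : ∀ a, M.kernel a a ≤ κ) (hθ : ‖θ‖ ≤ B)
    (hbest : ∀ v i, i ≠ best v → M.reward θ (v, i) < M.reward θ (v, best v)) {s : State V n}
    (hs : s.Shrunk M θ best (max 1 (√κ * B))) (hphase : 1 ≤ s.phase)
    (hlast : s.phase ≤ lastPhase (minGap M θ best)) :
    (numSamples M cfg s.phase s.alive : ℝ)
      ≤ (4096 * (1 + cfg.ε) ^ 2 * max 1 (√κ * B) ^ 2 + 4 * |κ| * B ^ 2)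
        * (rhoStar M θ best cfg.ξ
          * (Real.log (n * V / cfg.δ) + Real.log (logInv (minGap M θ best)))) := by
  have hL := one_le_logInv (minGap M θ best)
  have hε := hval.ε_pos
  have hlog := log_sampleSize_le hval hV hn hphase hL
    ((Nat.cast_le.2 hlast).trans (lastPhase_le _))
  have hlog0 := Real.log_pos (hval.one_lt_log_arg hV hn hphase)
  have hhalf := half_le_log_add_log hval hV hn hL
  have hone := one_le_mul_rhoStar hB hval hV hn hκ hθ hbest
  have hG : 0 < max 1 (√κ * B) := one_pos.trans_le (le_max_left _ _)
  have hopt : ((2 : ℝ) ^ s.phase) ^ 2 * M.optValue (cfg.ξ s.phase) s.alive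
      ≤ 64 * max 1 (√κ * B) ^ 2 * rhoStar M θ best cfg.ξ :=
    optValue_mul_le_hardness hV (one_le_two.trans hn) hbest
      (minReg_pos (hphase.trans hlast) hval.ξ_pos) (minReg_le hphase hlast) hG hs
  have hopt0 := Model.optValue_nonneg (M := M) (hval.ξ_pos _ hphase) s.alive
  have hκ0 : 0 ≤ κ := nonneg_of_kernel_le hκ (⟨0, hV⟩, best ⟨0, hV⟩)
  rw [abs_of_nonneg hκ0]
  set Λ := Real.log (n * V / cfg.δ) + Real.log (logInv (minGap M θ best))
  set ρ := rhoStar M θ best cfg.ξ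
  set G := max 1 (√κ * B)
  set ℓ := Real.log (2 * (n : ℝ) ^ 2 * V / cfg.deltaAt s.phase) with hℓ
  have hρ : 0 ≤ ρ := by
    by_contra! h
    have : 2 * κ * B ^ 2 * ρ ≤ 0 := mul_nonpos_of_nonneg_of_nonpos (by positivity) h.le
    linarith
  have hceil := (Nat.ceil_lt_add_one (a := 8 * ((2 : ℝ) ^ s.phase) ^ 2 * (1 + cfg.ε) ^ 2
    * M.optValue (cfg.ξ s.phase) s.alive * ℓ) (by positivity)).le
  refine hceil.trans ?_
  have h1 : 8 * ((2 : ℝ) ^ s.phase) ^ 2 * (1 + cfg.ε) ^ 2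
      * M.optValue (cfg.ξ s.phase) s.alive * ℓ ≤ 4096 * (1 + cfg.ε) ^ 2 * G ^ 2 * (ρ * Λ) := by
    calc 8 * ((2 : ℝ) ^ s.phase) ^ 2 * (1 + cfg.ε) ^ 2
          * M.optValue (cfg.ξ s.phase) s.alive * ℓ
        = 8 * (1 + cfg.ε) ^ 2 * (((2 : ℝ) ^ s.phase) ^ 2
          * M.optValue (cfg.ξ s.phase) s.alive) * ℓ := by ring
      _ ≤ 8 * (1 + cfg.ε) ^ 2 * (64 * G ^ 2 * ρ) * (8 * Λ) := by gcongr
      _ = _ := by ring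
  have h2 : 1 ≤ 4 * κ * B ^ 2 * (ρ * Λ) := by
    calc (1 : ℝ) ≤ (2 * κ * B ^ 2 * ρ) * (2 * Λ) :=
          one_le_mul_of_one_le_of_one_le hone (by linarith)
      _ = _ := by ring
  linarith

end SampleBound

/-! ### Union bound over phases and conclusion -/

section Union

lemma sum_range_inv_sq_le (m : ℕ) :
    ∑ k ∈ Finset.range m, 1 / ((k : ℝ) + 1) ^ 2 ≤ 4 - 2 / ((m : ℝ) + 1) := by
  induction m with
  | zero => norm_num
  | succ m ih =>
    rw [Finset.sum_range_succ]
    -- Telescoping majorant; the crude total `4` suffices because phase `t` fails with probability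
    -- at most `δ_t / 2 = δ / (4 t²)`.
    have h : 1 / ((m : ℝ) + 1) ^ 2 ≤ 2 / ((m : ℝ) + 1) - 2 / ((m : ℝ) + 1 + 1) := by
      rw [div_sub_div _ _ (by positivity) (by positivity), div_le_div_iff₀ (by positivity)
        (by positivity)]
      have : (0 : ℝ) ≤ m := Nat.cast_nonneg m
      nlinarith [mul_nonneg this this, mul_nonneg this (mul_nonneg this this)]
    push_cast
    linarith

variable {M : Model d V n Z H} {cfg : Config V n} {θ : H} {B : ℝ} [CompleteSpace H]
  {Ω : Type w} [MeasurableSpace Ω] {μ : Measure Ω} [IsProbabilityMeasure μ]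
  {η : Fin V → ℕ → Fin n → Ω → ℝ}

lemma measure_exists_inaccurate_le (hB : 0 < B) (hθ : ‖θ‖ ≤ B)
    (hval : cfg.Valid M B) (hV : 1 ≤ V) (hn : 2 ≤ n)
    (hη : ∀ v τ i, Measurable (η v τ i))
    (hsub : ∀ v τ i, HasSubgaussianMGF (η v τ i) 1 μ)
    (hind : iIndepFun (fun (p : Fin V × ℕ) (ω : Ω) (i : Fin n) => η p.1 p.2 i ω) μ) (T : ℕ) :
    μ.real (⋃ k ∈ Finset.range T,
      {ω | (run M cfg (rewardTable M θ η ω) k).Sound M cfg ∧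
        Inaccurate M cfg θ (run M cfg (rewardTable M θ η ω) k) (rewardTable M θ η ω)})
      ≤ cfg.δ := by
  have hδ := hval.δ_pos
  refine (measureReal_biUnion_finset_le _ _).trans ?_
  calc _ ≤ ∑ k ∈ Finset.range T, cfg.δ / 4 * (1 / ((k : ℝ) + 1) ^ 2) := by
        refine Finset.sum_le_sum fun k _ => ?_
        have hq : cfg.deltaAt (k + 1) / 2 = cfg.δ / 4 * (1 / ((k : ℝ) + 1) ^ 2) := by
          rw [Config.deltaAt]
          push_cast
          field_simp
          norm_num
        rw [← hq]
        refine ENNReal.toReal_le_of_le_ofReal (by rw [hq]; positivity) ?_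
        refine measure_run_inaccurate_le M cfg θ hη hind k (fun s => s.Sound M cfg) _
          fun s hs hsound => ?_
        rw [← hs, ← ofReal_measureReal]
        exact ENNReal.ofReal_le_ofReal
          (measure_inaccurate_le hB hθ hval hV hn hsound hsub hind)
    _ ≤ cfg.δ / 4 * 4 := by
        rw [← Finset.mul_sum]
        gcongr
        refine (sum_range_inv_sq_le T).trans ?_
        have : 0 ≤ 2 / ((T : ℝ) + 1) := by positivity
        linarith
    _ = cfg.δ := by ring

end Union

end CoopKernel

theorem theorem1 :
    ∃ C₀ : ℝ, 0 < C₀ ∧ ∀ ε B κ : ℝ, 0 < ε → 0 < B → ∃ C : ℝ, 0 < C ∧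
      ∀ (d V n : ℕ), 1 ≤ V → 2 ≤ n →
      ∀ (Z : Type u) (H : Type v) [NormedAddCommGroup H] [InnerProductSpace ℝ H] [CompleteSpace H]
        (M : CoopKernel.Model d V n Z H) (θ : H) (best : Fin V → Fin n)
        (cfg : CoopKernel.Config V n)
        (Ω : Type w) [MeasurableSpace Ω] (μ : Measure Ω) [IsProbabilityMeasure μ]
        -- noise `η v τ i` of the `τ`-th sample of agent `v`, if that sample is of arm `i`
        (η : Fin V → ℕ → Fin n → Ω → ℝ),
        (∀ a, M.kernel a a ≤ κ) →
        ‖θ‖ ≤ B →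
        (∀ v i, i ≠ best v → M.reward θ (v, i) < M.reward θ (v, best v)) →
        (∀ v τ i, Measurable (η v τ i)) →
        (∀ v τ i, HasSubgaussianMGF (η v τ i) 1 μ) →
        iIndepFun (fun (p : Fin V × ℕ) (ω : Ω) (i : Fin n) => η p.1 p.2 i ω) μ →
        cfg.ε = ε →
        cfg.Valid M B →
        (∀ ω, CoopKernel.RoundsWell M cfg (CoopKernel.rewardTable M θ η ω)) →
        1 - cfg.δ ≤ μ.real {ω | ∃ s,
          CoopKernel.TerminatesIn M cfg (CoopKernel.rewardTable M θ η ω) s ∧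
          (∀ v, s.alive v = {best v}) ∧
          s.perAgentSamples
            ≤ C * (CoopKernel.rhoStar M θ best cfg.ξ / V
                * CoopKernel.logInv (CoopKernel.minGap M θ best)
                * (Real.log (n * V / cfg.δ)
                  + Real.log (CoopKernel.logInv (CoopKernel.minGap M θ best)))) ∧
          (s.rounds : ℝ) ≤ C₀ * CoopKernel.logInv (CoopKernel.minGap M θ best)} := by
  -- Both factors `4` come from `lastPhase ≤ 4 L`. The absolute value keeps `C` positive, since `C`
  -- is chosen before `κ ≥ 0` is known.
  refine ⟨4, by norm_num, fun ε B κ hε hB =>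
    ⟨4 * (4096 * (1 + ε) ^ 2 * max 1 (√κ * B) ^ 2 + 4 * |κ| * B ^ 2), by positivity, ?_⟩⟩
  intro d V n hV hn Z H _ _ _ M θ best cfg Ω _ μ _ η hκ hθ hbest hη hsub hind hcε hval hround
  subst hcε
  set T := CoopKernel.lastPhase (CoopKernel.minGap M θ best)
  set bad : Set Ω := ⋃ k ∈ Finset.range T,
    {ω | (CoopKernel.run M cfg (CoopKernel.rewardTable M θ η ω) k).Sound M cfg ∧
      CoopKernel.Inaccurate M cfg θ (CoopKernel.run M cfg (CoopKernel.rewardTable M θ η ω) k)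
        (CoopKernel.rewardTable M θ η ω)} with hbad
  have hbadle : μ.real bad ≤ cfg.δ :=
    CoopKernel.measure_exists_inaccurate_le hB hθ hval hV hn hη hsub hind T
  have hcompl : 1 - cfg.δ ≤ μ.real badᶜ := by
    have h := measureReal_union_le (μ := μ) bad badᶜ
    rw [Set.union_compl_self, probReal_univ] at h
    linarith
  refine hcompl.trans (measureReal_mono fun ω hω => ?_)
  have hacc : ∀ k < T, (CoopKernel.run M cfg (CoopKernel.rewardTable M θ η ω) k).Sound M cfg →
      ¬ CoopKernel.Inaccurate M cfg θ (CoopKernel.run M cfg (CoopKernel.rewardTable M θ η ω) k)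
        (CoopKernel.rewardTable M θ η ω) := fun k hk hs hi =>
    hω (Set.mem_biUnion (Finset.mem_coe.2 (Finset.mem_range.2 hk)) ⟨hs, hi⟩)
  obtain ⟨k, hkT, hrun, hnot, halive⟩ :=
    CoopKernel.exists_terminates hval hV hn hκ hθ hbest (hround ω) hacc
  have hTL := CoopKernel.lastPhase_le (CoopKernel.minGap M θ best)
  have hkL : (k : ℝ) ≤ 4 * CoopKernel.logInv (CoopKernel.minGap M θ best) :=
    (Nat.cast_le.2 hkT).trans hTL
  refine ⟨_, ⟨k, hrun, hnot, rfl⟩, halive, ?_, by rw [CoopKernel.run_rounds]; exact hkL⟩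
  have hclock := CoopKernel.sum_clock_run_le (hround ω) hrun fun j hj =>
    CoopKernel.numSamples_le hB hval hV hn hκ hθ hbest
      (CoopKernel.shrunk_run hval hV hn hκ hθ hbest (hround ω) hacc (hj.le.trans hkT)
        fun i hi => hrun i (hi.trans hj)).1
      (by rw [CoopKernel.run_phase]; exact Nat.le_add_left _ _)
      (by rw [CoopKernel.run_phase]; exact Nat.succ_le_of_lt (hj.trans_le hkT))
  have hone := CoopKernel.one_le_mul_rhoStar hB hval hV hn hκ hθ hbest
  have hκ0 : 0 ≤ κ := CoopKernel.nonneg_of_kernel_le hκ (⟨0, hV⟩, best ⟨0, hV⟩)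
  have hhalf := CoopKernel.half_le_log_add_log hval hV hn
    (CoopKernel.one_le_logInv (CoopKernel.minGap M θ best))
  set ρ := CoopKernel.rhoStar M θ best cfg.ξ
  have hρ : 0 ≤ ρ := by
    by_contra! h
    have : 2 * κ * B ^ 2 * ρ ≤ 0 := mul_nonpos_of_nonneg_of_nonpos (by positivity) h.le
    linarith
  set L := CoopKernel.logInv (CoopKernel.minGap M θ best)
  set Λ := Real.log (n * V / cfg.δ) + Real.log L
  set C := 4096 * (1 + cfg.ε) ^ 2 * max 1 (√κ * B) ^ 2 + 4 * |κ| * B ^ 2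
  have hC : 0 ≤ C := by positivity
  have hΛ : 0 ≤ Λ := by linarith
  rw [CoopKernel.State.perAgentSamples]
  calc _ ≤ (4 * L) * (C * (ρ * Λ)) / V := by
        gcongr
        exact hclock.trans (by gcongr)
    _ = _ := by ring
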